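/- Let $\varphi$ be the Fibonacci substitution $0\mapsto 01,\ 1\mapsto 0$, and let $\Phi=(1+\sqrt5)/2$. A substitution $\eta$ on a finite alphabet $A$ assigns to every letter a nonempty word over $A$ and extends to words by concatenation. Its incidence matrix has as entry $(a,b)$ the number of occurrences of $b$ in $\eta(a)$. The substitution is primitive if some positive power of this matrix has only positive entries, injective if $\eta(a)\ne\eta(b)$ for letters $a\neq b$, and of full rank if the determinant of this matrix is nonzero. Its Perron–Frobenius eigenvalue is the nonnegative real eigenvalue of maximal modulus. Its language $\mathcal L_\eta$ is the set of all factors of the words $\eta^k(a)$ ($k\ge0$, $a\in A$), and its system is $(X_\eta,\sigma)$, where $X_\eta\subseteq A^{\mathbb Z}$ is the set of bi-infinite sequences all of whose finite factors are in $\mathcal L_\eta$ and $\sigma$ is the shift. Two systems are topologically conjugate if there is a homeomorphism between them that commutes with the shifts. **Theorem.** There are infinitely many primitive, injective substitutions (on alphabets $\{1,\dots,r\}$, $r\in\mathbb N$) with Perron–Frobenius eigenvalue $\Phi$ whose systems are topologically conjugate to the Fibonacci system $(X_\varphi,\sigma)$. More precisely, let $F_1=F_2=1$, $F_{n}=F_{n-1}+F_{n-2}$.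 For $n\ge5$ let $v=v_1\dots v_{F_{n-2}}$ be the word obtained from $\varphi^{n-4}(0)$ by moving its first letter to the end, and define a substitution $\eta_n$ on $\{1,\dots,F_n\}$ as follows. * For $1\le k\le F_{n-2}$ the image of $F_{n-1}+k$ has length $2-v_k$, and the concatenation of these images for $k=1,\dots,F_{n-2}$ is $1\,2\cdots F_{n-1}$. * The image of $F_{n-3}+1$ is the two-letter word $F_{n-1},\,F_{n-1}+1$; and $\eta_n(a)=a+F_{n-2}$ (a single letter) for $F_{n-3}+1<a\le F_{n-1}$. * The images of $1,\dots,F_{n-3}$ are nonempty words whose concatenation is $1\,2\cdots (F_{n-1}-1)$; the inner cut positions of the partition of $1\,2\cdots F_{n-1}$ into these words and the last letter $F_{n-1}$ are exactly the positions in $\{1,\dots,F_{n-1}-1\}$ that are not cut positions of the partition in the first item. Then for every $n\ge5$ the substitution $\eta_n$ is primitive, injective and of full rank, it has Perron–Frobenius eigenvalue $\Phi$, and $(X_{\eta_n},\sigma)$ is topologically conjugate to $(X_\varphi,\sigma)$. Moreover, let $N=F_n-1$. Then the words of length $N$ at the positions $1,\dots,F_n$ of the infinite Fibonacci word $0100101001\dots$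 are distinct and are all the words of length $N$ in $\mathcal L_\varphi$. Code them by $1,\dots,F_n$ in this order, and let $\hat\varphi_N$ be the $N$-block substitution in this coding: $\hat\varphi_N([a_1\dots a_N])$ consists of the codes of the first $|\varphi(a_1)|$ consecutive words of length $N$ in $\varphi(a_1\dots a_N)$. Then $\eta_n$ is a partition reshaping of $\hat\varphi_N$: the two substitutions have the same image on the word $1\,2\cdots F_{n-1}$ and the same image on the word $F_{n-1}+1\cdots F_n$, and $\mathcal L_{\eta_n}=\mathcal L_{\hat\varphi_N}$. -/

import Mathlib

namespace Substitutions

open SymbolicDynamics.FullShift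

section General

variable {A B : Type}

/-- A map `A → List A` is a substitution when it sends every letter to a nonempty word.
It acts on words by concatenation, `w ↦ w.flatMap η`. -/
def IsSubstitution (η : A → List A) : Prop := ∀ a, η a ≠ []

/-- The word `η^k(w)`. -/
def iter (η : A → List A) (k : ℕ) (w : List A) : List A := (fun u => u.flatMap η)^[k] w

/-- The language of `η`: all words that occur as a factor in some `η^k(a)`, `a` a letter. -/
def language (η : A → List A) : Set (List A) := {w | ∃ (k : ℕ) (a : A), w <:+: iter η k [a]}

/-- The word `x_i x_{i+1} ... x_{i+n-1}` read in the bi-infinite sequence `x`. -/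
def window (x : ℤ → A) (i : ℤ) (n : ℕ) : List A := List.ofFn fun j : Fin n => x (i + (j : ℕ))

/-- The bi-infinite sequences all of whose finite factors are in the language of `η`. -/
def systemSet (η : A → List A) : Set (ℤ → A) := {x | ∀ (i : ℤ) (n : ℕ), window x i n ∈ language η}

theorem isClosed_systemSet [TopologicalSpace A] [DiscreteTopology A] (η : A → List A) :
    IsClosed (systemSet η) := by
  have h : systemSet η = ⋂ (i : ℤ) (n : ℕ), (fun (x : ℤ → A) (j : Fin n) => x (i + (j : ℕ))) ⁻¹'
      {f | List.ofFn f ∈ language η} := by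
    ext x
    simp [systemSet, window]
  rw [h]
  exact isClosed_iInter fun i => isClosed_iInter fun n =>
    (isClosed_discrete _).preimage (continuous_pi fun j => continuous_apply _)

theorem mapsTo_systemSet (η : A → List A) (g : ℤ) :
    Set.MapsTo (shift g) (systemSet η) (systemSet η) := by
  intro x hx i n
  have h := hx (g + i) n
  simpa [window, add_assoc] using h

/-- The subshift `X_η` generated by the substitution `η`. -/
def system [TopologicalSpace A] [DiscreteTopology A] (η : A → List A) : Subshift A ℤ where
  carrier := systemSet η
  isClosed := isClosed_systemSet η
  mapsTo := mapsTo_systemSet η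

/-- The shift `(σ x)_i = x_{i+1}` as a self-map of a subshift. -/
def shiftMap [TopologicalSpace A] (X : Subshift A ℤ) : X.carrier → X.carrier :=
  (X.mapsTo 1).restrict

/-- Topological conjugacy of two subshifts: a homeomorphism that commutes with the shifts. -/
def Conjugate [TopologicalSpace A] [TopologicalSpace B]
    (X : Subshift A ℤ) (Y : Subshift B ℤ) : Prop :=
  ∃ ψ : X.carrier ≃ₜ Y.carrier, Function.Semiconj ψ (shiftMap X) (shiftMap Y)

/-- The incidence matrix: the entry at `(a, b)` is the number of occurrences of `b` in `η(a)`. -/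
def incidence [DecidableEq A] (η : A → List A) : Matrix A A ℝ :=
  Matrix.of fun a b => ((η a).count b : ℝ)

/-- `l` is the Perron-Frobenius eigenvalue of `M`: it is a nonnegative real eigenvalue of `M`,
and no complex eigenvalue of `M` has larger modulus. -/
def IsPerronFrobeniusEigenvalue [Fintype A] [DecidableEq A] (M : Matrix A A ℝ) (l : ℝ) : Prop :=
  0 ≤ l ∧ Module.End.HasEigenvalue (Matrix.toLin' M) l ∧
    ∀ z : ℂ, Module.End.HasEigenvalue (Matrix.toLin' (M.map Complex.ofReal)) z → ‖z‖ ≤ l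

/-- The image of an `N`-block `w = a_1 ... a_N` under the `N`-block substitution of `θ`: the first
`|θ(a_1)|` consecutive words of length `N` in `θ(w)`. -/
def blockImage (θ : A → List A) (N : ℕ) (w : List A) : List (List A) :=
  (List.range ((w.take 1).flatMap θ).length).map fun i => ((w.flatMap θ).drop i).take N

/-- `θN` is the `N`-block substitution of `θ`, written on the alphabet `B` by means of the coding
`code` of the letters in `B` by the words of length `N` in the language of `θ`. -/
structure IsBlockSubstitution (θ : A → List A) (N : ℕ) (code : B → List A)
    (θN : B → List B) : Prop where
  bijOn : Set.BijOn code Set.univ {w | w ∈ language θ ∧ w.length = N}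
  map_code : ∀ b, (θN b).map code = blockImage θ N (code b)

/-- `η` is a partition reshaping of `θ` along the given blocks: the blocks use every letter exactly
once, `η` and `θ` have the same images on each block (so `η` results from another partition of these
images into subwords), and the language is preserved. -/
structure IsPartitionReshaping (θ η : A → List A) (blocks : List (List A)) : Prop where
  nodup : blocks.flatten.Nodup
  cover : ∀ a, a ∈ blocks.flatten
  image_eq : ∀ w ∈ blocks, w.flatMap η = w.flatMap θ
  language_eq : language η = language θ

end General

/-- The Fibonacci substitution `0 → 01, 1 → 0`. -/
def fibSubst : Fin 2 → List (Fin 2) := ![[0, 1], [0]]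

/-- The infinite Fibonacci word `0100101001...`, the fixed point of the Fibonacci substitution
(its prefix `fibSubst^m(0)` has more than `m` letters). -/
def fibWord (m : ℕ) : Fin 2 := (iter fibSubst m [0]).getD m 0

/-- The word of length `N` at position `a` in the infinite Fibonacci word. -/
def fibBlock (N a : ℕ) : List (Fin 2) := (List.range N).map fun j => fibWord (a + j)

/-- `η` is a primitive, injective substitution with Perron-Frobenius eigenvalue the golden mean
and its system is topologically conjugate to the Fibonacci system. -/
structure IsFibonacciLike {r : ℕ} (η : Fin r → List (Fin r)) : Prop where
  isSubstitution : IsSubstitution η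
  primitive : (incidence η).IsPrimitive
  injective : Function.Injective η
  eigenvalue : IsPerronFrobeniusEigenvalue (incidence η) Real.goldenRatio
  conjugate : Conjugate (system fibSubst) (system η)

section Family

/-! The explicit family. Letters are numbered from `0`, so that the letter `a` of the alphabet
`{1, ..., F_n}` is `a - 1 : Fin (F_n)`. -/

/-- The word `lo, lo+1, ..., hi-1` over `Fin r`. -/
def interval (r lo hi : ℕ) : List (Fin r) :=
  (List.finRange r).filter fun j => decide (lo ≤ (j : ℕ) ∧ (j : ℕ) < hi)

/-- The word `v`: `fibSubst^(n-4)(0)` with its first letter moved to the end. -/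
def rotatedWord (n : ℕ) : List (Fin 2) := (iter fibSubst (n - 4) [0]).rotate 1

/-- The total length `∑_{j ≤ k} (2 - v_j)` of the images of the first `k` letters of `L`. -/
def cutL (n k : ℕ) : ℕ := (((rotatedWord n).take k).map fun c => 2 - (c : ℕ)).sum

/-- The places in `1 2 ... F_{n-1}` (numbers of letters to the left) at which the images of the
letters of `S` start or end: `0`, and every inner place that is not a cut between the images of two
letters of `L`, so that the common refinement of the two partitions is into single letters. -/
def cutsS (n : ℕ) : List ℕ :=
  (List.range (Nat.fib (n - 1))).filter fun c =>
    decide (c = 0 ∨ ∀ k < Nat.fib (n - 2), c ≠ cutL n k)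

/-- The substitution `η_n` on `F_n` letters, `n ≥ 5`. The four cases are the letters of `S` (the
first `F_{n-3}`), the first letter of `M`, the other letters of `M` (up to `F_{n-1}`), and the
letters of `L`. -/
def eta (n : ℕ) (a : Fin (Nat.fib n)) : List (Fin (Nat.fib n)) :=
  if (a : ℕ) < Nat.fib (n - 3) then
    interval _ ((cutsS n).getD a 0) ((cutsS n).getD (a + 1) 0)
  else if (a : ℕ) = Nat.fib (n - 3) then
    interval _ (Nat.fib (n - 1) - 1) (Nat.fib (n - 1) + 1)
  else if (a : ℕ) < Nat.fib (n - 1) then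
    interval _ (a + Nat.fib (n - 2)) (a + Nat.fib (n - 2) + 1)
  else
    interval _ (cutL n (a - Nat.fib (n - 1))) (cutL n (a - Nat.fib (n - 1) + 1))

/-- The words `1 2 ... F_{n-1}` and `F_{n-1}+1 ... F_n`. -/
def fibBlocks (n : ℕ) : List (List (Fin (Nat.fib n))) :=
  [interval _ 0 (Nat.fib (n - 1)), interval _ (Nat.fib (n - 1)) (Nat.fib n)]

end Family

end Substitutions

namespace Substitutions

/-! ### Iterates of substitutions and factors of infinite words. -/

section Words

variable {A B : Type}

/-! Let u be the infinite Fibonacci word and N = F_n - 1. By Sturmian complexity u has exactly F_n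
factors of length N, one at each of the positions 0, ..., F_n - 1 (`exists_lt_fib_factor_eq`,
`factor_fibWord_injOn`). So the sequence C of codes of the N-blocks of u begins with 0 1 ... F_n -
1, and for m ≥ n its prefix of length F_{m+1} is the prefix of length F_m followed by the one of
length F_{m-1} (`IsFibCoding.factor_fib_succ`).

Put w₁ = 0 ... F_{n-1}-1 and let w₂ consist of the remaining letters in order. If a substitution
maps w₁ to w₁w₂ and w₂ to w₁, then this recursion makes it map Fibonacci prefixes of C to Fibonacci
prefixes of C, no matter how the two images are cut into images of letters
(`IsReshaped.flatMap_factor`). If moreover the image of 0 properly extends 0, the language is the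
set of factors of C (`IsReshaped.language_eq`). Hence the language, the conjugacy with the Fibonacci
system (a recoding of blocks) and the eigenvalue (w₁ and w₂ transform by the matrix with rows (1,1)
and (1,0)) do not depend on the cutting. The block substitution and `eta n` are two instances.

The cutting decides the rest. If the cuts in the two images together exhaust 0, ..., F_n, the
incidence matrix has trivial kernel (`IsIntervalSubst.det_ne_zero`); if no interval occurs in both
partitions, the substitution is injective (`IsIntervalSubst.injective`). The complementary cuts of
`eta n` give both. Primitivity follows once every letter eventually grows, by a descent on letters
(`exists_two_le_length_iter_eta`). -/

theorem iter_zero (η : A → List A) (w : List A) : iter η 0 w = w := rfl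

theorem iter_succ (η : A → List A) (k : ℕ) (w : List A) :
    iter η (k + 1) w = iter η k (w.flatMap η) := rfl

theorem iter_succ' (η : A → List A) (k : ℕ) (w : List A) :
    iter η (k + 1) w = (iter η k w).flatMap η :=
  Function.iterate_succ_apply' _ _ _

theorem iter_add (η : A → List A) (k l : ℕ) (w : List A) :
    iter η (k + l) w = iter η k (iter η l w) :=
  Function.iterate_add_apply _ _ _ _

theorem iter_append (η : A → List A) (k : ℕ) (u v : List A) :
    iter η k (u ++ v) = iter η k u ++ iter η k v := by
  induction k generalizing u v with
  | zero => rfl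
  | succ k ih => rw [iter_succ, iter_succ, iter_succ, List.flatMap_append, ih]

theorem iter_infix (η : A → List A) (k : ℕ) {u v : List A} (h : u <:+: v) :
    iter η k u <:+: iter η k v := by
  obtain ⟨s, t, rfl⟩ := h
  exact ⟨iter η k s, iter η k t, by simp only [iter_append]⟩

theorem length_le_length_flatMap {η : A → List A} (hη : IsSubstitution η) (w : List A) :
    w.length ≤ (w.flatMap η).length := by
  induction w with
  | nil => simp
  | cons a w ih =>
    have := List.length_pos_of_ne_nil (hη a)
    simp only [List.flatMap_cons, List.length_append, List.length_cons]
    omega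

theorem length_le_length_iter {η : A → List A} (hη : IsSubstitution η) (k : ℕ) (w : List A) :
    w.length ≤ (iter η k w).length := by
  induction k with
  | zero => rfl
  | succ k ih => exact ih.trans (by rw [iter_succ']; exact length_le_length_flatMap hη _)

/-- The word of length `l` at position `p` in the infinite word `u`. -/
def factor (u : ℕ → A) (l p : ℕ) : List A := (List.range l).map fun j => u (p + j)

@[simp] theorem length_factor (u : ℕ → A) (l p : ℕ) : (factor u l p).length = l := by
  simp [factor]

@[simp] theorem getElem_factor (u : ℕ → A) (l p i : ℕ) (h : i < (factor u l p).length) :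
    (factor u l p)[i] = u (p + i) := by
  simp [factor]

theorem factor_eq_factor {u v : ℕ → A} {l p q : ℕ} :
    factor u l p = factor v l q ↔ ∀ j < l, u (p + j) = v (q + j) := by
  simp [factor]

theorem factor_add (u : ℕ → A) (l m p : ℕ) :
    factor u (l + m) p = factor u l p ++ factor u m (p + l) := by
  simp [factor, List.range_add, add_assoc, Function.comp_def]

theorem factor_succ (u : ℕ → A) (l p : ℕ) : factor u (l + 1) p = u p :: factor u l (p + 1) := by
  rw [add_comm l 1, factor_add]; rfl

theorem take_factor (u : ℕ → A) (l m p : ℕ) (h : m ≤ l) :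
    (factor u l p).take m = factor u m p := by
  obtain ⟨k, rfl⟩ := Nat.exists_eq_add_of_le h
  rw [factor_add, List.take_left' (by simp)]

theorem drop_factor (u : ℕ → A) (l m p : ℕ) (h : m ≤ l) :
    (factor u l p).drop m = factor u (l - m) (p + m) := by
  obtain ⟨k, rfl⟩ := Nat.exists_eq_add_of_le h
  rw [factor_add, List.drop_left' (by simp), Nat.add_sub_cancel_left]

theorem map_factor (f : A → B) (u : ℕ → A) (l p : ℕ) :
    (factor u l p).map f = factor (fun i => f (u i)) l p := by
  simp [factor, Function.comp_def]

theorem mem_factor {u : ℕ → A} {l p : ℕ} {a : A} :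
    a ∈ factor u l p ↔ ∃ j < l, u (p + j) = a := by
  simp [factor]

theorem factor_infix (u : ℕ → A) (l p : ℕ) : factor u l p <:+: factor u (p + l) 0 :=
  ⟨factor u p 0, [], by simp [factor_add]⟩

theorem factor_prefix (u : ℕ → A) {l m : ℕ} (p : ℕ) (h : l ≤ m) :
    factor u l p <+: factor u m p := by
  obtain ⟨k, rfl⟩ := Nat.exists_eq_add_of_le h
  exact ⟨_, (factor_add u l k p).symm⟩

theorem exists_eq_factor_of_infix {u : ℕ → A} {l p : ℕ} {w : List A} (h : w <:+: factor u l p) :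
    ∃ q, w = factor u w.length q := by
  obtain ⟨s, t, hst⟩ := h
  have hl : s.length + w.length + t.length = l := by
    simpa [add_assoc] using congrArg List.length hst
  refine ⟨p + s.length, ?_⟩
  have h1 : w = ((s ++ w ++ t).drop s.length).take w.length := by simp
  rw [hst, drop_factor _ _ _ _ (by omega), take_factor _ _ _ _ (by omega)] at h1
  exact h1

/-- The set of all factors of the infinite word `u`. -/
def factors (u : ℕ → A) : Set (List A) := {w | ∃ p, w = factor u w.length p}

theorem factor_mem_factors (u : ℕ → A) (l p : ℕ) : factor u l p ∈ factors u := ⟨p, by simp⟩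

theorem mem_factors_of_infix {u : ℕ → A} {v w : List A} (h : w <:+: v) (hv : v ∈ factors u) :
    w ∈ factors u := by
  obtain ⟨p, hp⟩ := hv
  rw [hp] at h
  exact exists_eq_factor_of_infix h

theorem language_eq_factors {η : A → List A} {u : ℕ → A}
    (h₁ : ∀ k a, iter η k [a] ∈ factors u)
    (h₂ : ∀ l, ∃ k a, factor u l 0 <:+: iter η k [a]) : language η = factors u := by
  ext w
  constructor
  · rintro ⟨k, a, h⟩
    exact mem_factors_of_infix h (h₁ k a)
  · rintro ⟨p, hp⟩
    obtain ⟨k, a, h⟩ := h₂ (p + w.length)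
    refine ⟨k, a, ?_⟩
    rw [hp]
    exact (factor_infix u w.length p).trans h

end Words

/-! ### Self-similarity and factor complexity of the Fibonacci word. -/

section FibonacciWord

theorem iter_fibSubst_add_two (k : ℕ) :
    iter fibSubst (k + 2) [0] = iter fibSubst (k + 1) [0] ++ iter fibSubst k [0] := by
  have h1 : iter fibSubst (k + 1) [1] = iter fibSubst k [0] := rfl
  have h2 : iter fibSubst (k + 2) [0] = iter fibSubst (k + 1) ([0] ++ [1]) := rfl
  rw [h2, iter_append, h1]

theorem length_iter_fibSubst (k : ℕ) : (iter fibSubst k [0]).length = Nat.fib (k + 2) := by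
  induction k using Nat.twoStepInduction with
  | zero => rfl
  | one => rfl
  | more k h1 h2 =>
    rw [iter_fibSubst_add_two, List.length_append, h1, h2, Nat.fib_add_two (n := k + 2), add_comm]

theorem iter_fibSubst_prefix {k l : ℕ} (h : k ≤ l) :
    iter fibSubst k [0] <+: iter fibSubst l [0] := by
  induction l, h using Nat.le_induction with
  | base => exact List.prefix_rfl
  | succ l _ ih =>
    refine ih.trans ?_
    cases l with
    | zero => exact ⟨[1], rfl⟩
    | succ l => rw [iter_fibSubst_add_two]; exact List.prefix_append _ _

theorem getElem_iter_fibSubst {k m : ℕ} (h : m < (iter fibSubst k [0]).length) :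
    (iter fibSubst k [0])[m] = fibWord m := by
  have hm : m < (iter fibSubst m [0]).length := by
    rw [length_iter_fibSubst]
    have := Nat.le_fib_add_one (m + 2)
    omega
  rw [fibWord, List.getD_eq_getElem _ _ hm]
  rcases le_total k m with hkm | hkm
  · exact (iter_fibSubst_prefix hkm).getElem h
  · exact ((iter_fibSubst_prefix hkm).getElem hm).symm

theorem iter_fibSubst_eq_factor (k : ℕ) :
    iter fibSubst k [0] = factor fibWord (Nat.fib (k + 2)) 0 := by
  refine List.ext_getElem (by simp [length_iter_fibSubst]) fun i h1 h2 => ?_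
  rw [getElem_iter_fibSubst, getElem_factor, zero_add]

theorem fibWord_fib_add {m i : ℕ} (hm : 3 ≤ m) (hi : i < Nat.fib (m - 1)) :
    fibWord (Nat.fib m + i) = fibWord i := by
  obtain ⟨k, rfl⟩ := Nat.exists_eq_add_of_le' hm
  have h := iter_fibSubst_add_two k
  rw [iter_fibSubst_eq_factor, iter_fibSubst_eq_factor, iter_fibSubst_eq_factor,
    show Nat.fib (k + 2 + 2) = Nat.fib (k + 1 + 2) + Nat.fib (k + 2) by
      rw [Nat.fib_add_two (n := k + 2), add_comm], factor_add, List.append_cancel_left_eq,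
    factor_eq_factor] at h
  simpa using h i hi

/-- The two concatenations of consecutive Fibonacci prefixes differ only in their last two letters;
hence the bound with `i + 2`. This sharp range is what later allows blocks as long as F_n - 1. -/
theorem fibWord_fib_add' {m i : ℕ} (hm : 2 ≤ m) (hi : i + 2 < Nat.fib (m + 1)) :
    fibWord (Nat.fib m + i) = fibWord i := by
  induction m, hm using Nat.le_induction generalizing i with
  | base => simp [Nat.fib_add_two] at hi
  | succ m hm ih =>
    rcases lt_or_ge i (Nat.fib m) with h | h
    · exact fibWord_fib_add (by omega) (by simpa using h)
    · obtain ⟨j, rfl⟩ := Nat.exists_eq_add_of_le h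
      have h1 : Nat.fib (m + 2) = Nat.fib m + Nat.fib (m + 1) := Nat.fib_add_two
      have h2 : j + 2 < Nat.fib (m + 1) := by rw [h1] at hi; omega
      rw [ih h2, show Nat.fib (m + 1) + (Nat.fib m + j) = Nat.fib (m + 2) + j by omega]
      exact fibWord_fib_add (by omega) (by simp; omega)

/-- Prefixes of lengths F_k and F_{k+1} end in different letters; this provides two distinct left
extensions of every prefix. -/
theorem fibWord_fib_sub_one_ne {k : ℕ} (hk : 2 ≤ k) :
    fibWord (Nat.fib k - 1) ≠ fibWord (Nat.fib (k + 1) - 1) := by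
  induction k, hk using Nat.le_induction with
  | base => decide
  | succ k hk ih =>
    have h1 : Nat.fib (k + 1 + 1) = Nat.fib k + Nat.fib (k + 1) := Nat.fib_add_two
    have h2 : 0 < Nat.fib k := Nat.fib_pos.2 (by omega)
    rw [show Nat.fib (k + 1 + 1) - 1 = Nat.fib (k + 1) + (Nat.fib k - 1) by omega,
      fibWord_fib_add (by omega) (by rw [Nat.add_sub_cancel]; omega)]
    exact ih.symm

theorem finite_range_factor {A : Type} [Finite A] (u : ℕ → A) (l : ℕ) :
    (Set.range (factor u l)).Finite :=
  (List.finite_length_eq A l).subset (by rintro _ ⟨p, rfl⟩; simp)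

theorem exists_prefix_fibWord_ge (m : ℕ) : ∃ k, 2 ≤ k ∧ m + 2 < Nat.fib (k + 1) := by
  refine ⟨m + 5, by omega, ?_⟩
  have := Nat.le_fib_self (n := m + 5 + 1) (by omega)
  omega

/-- Deleting the first letter maps the factors of length m + 1 onto those of length m. It is not
injective, because the prefix of length m also occurs at positions F_k and F_{k+1}, preceded by
different letters. So the number of factors increases strictly with the length. -/
theorem lt_ncard_range_factor_fibWord (m : ℕ) : m < (Set.range (factor fibWord m)).ncard := by
  induction m with
  | zero =>
    rw [Set.ncard_pos (finite_range_factor _ _)]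
    exact Set.range_nonempty _
  | succ m ih =>
    refine lt_of_le_of_lt (Nat.succ_le_of_lt ih) ?_
    obtain ⟨k, hk, hmk⟩ := exists_prefix_fibWord_ge m
    have hmk' : m + 2 < Nat.fib (k + 1 + 1) := hmk.trans_le (Nat.fib_mono (by omega))
    have key : ∀ k, 2 ≤ k → m + 2 < Nat.fib (k + 1) →
        factor fibWord (m + 1) (Nat.fib k - 1) = fibWord (Nat.fib k - 1) :: factor fibWord m 0 := by
      intro k hk hmk
      have : 0 < Nat.fib k := Nat.fib_pos.2 (by omega)
      rw [factor_succ, Nat.sub_add_cancel this]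
      congr 1
      rw [factor_eq_factor]
      intro j hj
      rw [fibWord_fib_add' hk (by omega), zero_add]
    have himg : Set.range (factor fibWord m) = List.tail '' Set.range (factor fibWord (m + 1)) := by
      apply Set.eq_of_subset_of_subset
      · rintro _ ⟨p, rfl⟩
        -- A factor at p, possibly p = 0, recurs at F_k + p, where it has a letter to its left.
        obtain ⟨k, hk, hpk⟩ := exists_prefix_fibWord_ge (p + m)
        have h0 : 0 < Nat.fib k := Nat.fib_pos.2 (by omega)
        refine ⟨_, ⟨Nat.fib k + p - 1, rfl⟩, ?_⟩
        rw [factor_succ, List.tail_cons, factor_eq_factor]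
        intro j hj
        rw [show Nat.fib k + p - 1 + 1 + j = Nat.fib k + (p + j) by omega,
          fibWord_fib_add' hk (by omega)]
      · rintro _ ⟨_, ⟨p, rfl⟩, rfl⟩
        exact ⟨p + 1, by rw [factor_succ]; rfl⟩
    rw [himg]
    refine lt_of_le_of_ne (Set.ncard_image_le (finite_range_factor _ _)) fun h => ?_
    have hinj := (Set.ncard_image_iff (finite_range_factor _ _)).1 h
    have h3 := hinj ⟨_, key k hk hmk⟩ ⟨_, key (k + 1) (by omega) hmk'⟩ rfl
    exact fibWord_fib_sub_one_ne hk (List.cons.inj h3).1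

/-- The words of length less than `F_n` in the Fibonacci word occur at the first `F_n` positions. -/
theorem exists_lt_fib_factor_eq {n l : ℕ} (hn : 2 ≤ n) (hl : l < Nat.fib n) (p : ℕ) :
    ∃ a < Nat.fib n, factor fibWord l a = factor fibWord l p := by
  induction p using Nat.strong_induction_on with
  | _ p ih =>
    rcases lt_or_ge p (Nat.fib n) with h | h
    · exact ⟨p, h, rfl⟩
    -- Subtracting the largest Fibonacci number F_m ≤ p moves the occurrence to the left: the block
    -- ends early enough for `fibWord_fib_add'`, since p < F_{m+1} and l < F_n ≤ F_m.
    · have hm := Nat.le_greatestFib.2 h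
      have h1 := Nat.fib_greatestFib_le p
      have h2 := Nat.lt_fib_greatestFib_add_one p
      generalize p.greatestFib = m at hm h1 h2
      obtain ⟨j, rfl⟩ := Nat.exists_eq_add_of_le h1
      have h0 : 0 < Nat.fib m := Nat.fib_pos.2 (by omega)
      obtain ⟨a, ha, hap⟩ := ih j (by omega)
      refine ⟨a, ha, hap.trans ?_⟩
      have h3 : Nat.fib n ≤ Nat.fib m := Nat.fib_mono hm
      rw [factor_eq_factor]
      intro i hi
      rw [add_assoc, fibWord_fib_add' (by omega)]
      omega

end FibonacciWord

/-! ### The coded word C and the substitutions that preserve it. -/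

section Coding

theorem fib_eq_add {n : ℕ} (hn : 2 ≤ n) : Nat.fib n = Nat.fib (n - 1) + Nat.fib (n - 2) := by
  obtain ⟨k, rfl⟩ := Nat.exists_eq_add_of_le' hn
  rw [Nat.fib_add_two, add_comm]; rfl

theorem factor_fib_eq_append {A : Type} (C : ℕ → A) {n : ℕ} (hn : 2 ≤ n) :
    factor C (Nat.fib n) 0 =
      factor C (Nat.fib (n - 1)) 0 ++ factor C (Nat.fib (n - 2)) (Nat.fib (n - 1)) := by
  have h := factor_add C (Nat.fib (n - 1)) (Nat.fib (n - 2)) 0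
  rwa [← fib_eq_add hn, zero_add] at h

theorem range_factor_fibWord {n l : ℕ} (hn : 2 ≤ n) (hl : l < Nat.fib n) :
    Set.range (factor fibWord l) = factor fibWord l '' Set.Iio (Nat.fib n) := by
  refine Set.Subset.antisymm ?_ (Set.image_subset_range _ _)
  rintro _ ⟨p, rfl⟩
  obtain ⟨a, ha, h⟩ := exists_lt_fib_factor_eq hn hl p
  exact ⟨a, ha, h⟩

/-- Pigeonhole: more than F_n - 1 distinct words occur at only F_n positions, so no two positions
share a word. -/
theorem factor_fibWord_injOn {n : ℕ} (hn : 2 ≤ n) :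
    Set.InjOn (factor fibWord (Nat.fib n - 1)) (Set.Iio (Nat.fib n)) := by
  have h0 : 0 < Nat.fib n := Nat.fib_pos.2 (by omega)
  have h1 := lt_ncard_range_factor_fibWord (Nat.fib n - 1)
  rw [range_factor_fibWord hn (by omega)] at h1
  refine Set.injOn_of_ncard_image_eq (le_antisymm (Set.ncard_image_le (Set.finite_Iio _)) ?_)
    (Set.finite_Iio _)
  rw [Set.ncard_Iio_nat]
  omega

/-- `C` codes the words of length `F_n - 1` in the Fibonacci word by their first position. -/
def IsFibCoding (n : ℕ) (C : ℕ → Fin (Nat.fib n)) : Prop :=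
  ∀ p, factor fibWord (Nat.fib n - 1) (C p) = factor fibWord (Nat.fib n - 1) p

theorem exists_isFibCoding {n : ℕ} (hn : 2 ≤ n) : ∃ C, IsFibCoding n C := by
  have h0 : 0 < Nat.fib n := Nat.fib_pos.2 (by omega)
  choose f hf hfe using
    exists_lt_fib_factor_eq (l := Nat.fib n - 1) hn (by omega)
  exact ⟨fun p => ⟨f p, hf p⟩, hfe⟩

variable {n : ℕ} {C : ℕ → Fin (Nat.fib n)}

theorem IsFibCoding.eq_of_factor_eq (hC : IsFibCoding n C) {p : ℕ} {a : Fin (Nat.fib n)}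
    (h : factor fibWord (Nat.fib n - 1) a = factor fibWord (Nat.fib n - 1) p) : C p = a := by
  have hn : 1 ≤ n := Nat.fib_pos.1 a.pos
  rcases hn.eq_or_lt with rfl | hn
  · exact Subsingleton.elim (α := Fin 1) _ _
  exact Fin.ext (factor_fibWord_injOn hn (C p).2 a.2 ((hC p).trans h.symm))

theorem IsFibCoding.eq_iff (hC : IsFibCoding n C) {p q : ℕ} :
    C p = C q ↔ factor fibWord (Nat.fib n - 1) p = factor fibWord (Nat.fib n - 1) q :=
  ⟨fun h => by rw [← hC p, ← hC q, h], fun h => hC.eq_of_factor_eq ((hC q).trans h.symm)⟩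

theorem IsFibCoding.apply_fin (hC : IsFibCoding n C) (a : Fin (Nat.fib n)) : C a = a :=
  hC.eq_of_factor_eq rfl

theorem IsFibCoding.val_apply (hC : IsFibCoding n C) {p : ℕ} (hp : p < Nat.fib n) :
    (C p : ℕ) = p :=
  congrArg Fin.val (hC.apply_fin ⟨p, hp⟩)

theorem IsFibCoding.fib_add (hC : IsFibCoding n C) (hn : 2 ≤ n) {m j : ℕ} (hm : n ≤ m)
    (hj : j < Nat.fib (m - 1)) : C (Nat.fib m + j) = C j := by
  rw [hC.eq_iff, factor_eq_factor]
  intro i hi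
  have h1 : Nat.fib (m + 1) = Nat.fib m + Nat.fib (m - 1) := fib_eq_add (n := m + 1) (by omega)
  have h2 : Nat.fib n ≤ Nat.fib m := Nat.fib_mono hm
  rw [add_assoc, fibWord_fib_add' (by omega) (by omega)]

theorem IsFibCoding.factor_fib_succ (hC : IsFibCoding n C) (hn : 2 ≤ n) {m : ℕ} (hm : n ≤ m) :
    factor C (Nat.fib (m + 1)) 0 = factor C (Nat.fib m) 0 ++ factor C (Nat.fib (m - 1)) 0 := by
  have h1 : Nat.fib (m + 1) = Nat.fib m + Nat.fib (m - 1) := fib_eq_add (n := m + 1) (by omega)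
  rw [h1, factor_add, List.append_cancel_left_eq, factor_eq_factor]
  intro j hj
  rw [zero_add, zero_add, hC.fib_add hn hm hj]

theorem mem_interval {r lo hi : ℕ} {a : Fin r} : a ∈ interval r lo hi ↔ lo ≤ a ∧ (a : ℕ) < hi := by
  simp [interval]

/-- C is the identity on the first F_n positions, so both sides are strictly increasing lists with
the same members. -/
theorem IsFibCoding.interval_eq (hC : IsFibCoding n C) {lo hi : ℕ} (h : hi ≤ Nat.fib n) :
    interval (Nat.fib n) lo hi = factor C (hi - lo) lo := by
  refine List.Pairwise.eq_of_mem_iff (r := (· < ·)) ((List.pairwise_lt_finRange _).filter _) ?_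
    fun a => ?_
  · rw [List.pairwise_iff_getElem]
    intro i j h1 h2 hij
    rw [length_factor] at h1 h2
    rw [getElem_factor, getElem_factor, Fin.lt_def, hC.val_apply (by omega),
      hC.val_apply (by omega)]
    omega
  · rw [mem_interval, mem_factor]
    constructor
    · intro h1
      exact ⟨a - lo, by omega, by rw [Nat.add_sub_cancel' h1.1, hC.apply_fin]⟩
    · rintro ⟨j, hj, rfl⟩
      rw [hC.val_apply (by omega)]
      omega

/-- In the coding of the Fibonacci word, the gaps between zeros are at most `F_n`. -/
theorem IsFibCoding.exists_zero (hC : IsFibCoding n C) (hn : 2 ≤ n) (p : ℕ) :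
    ∃ q, p ≤ q ∧ q < p + Nat.fib n ∧ C q = C 0 := by
  have h0 : ∀ m, n ≤ m → C (Nat.fib m) = C 0 := fun m hm =>
    hC.fib_add hn hm (Nat.fib_pos.2 (by omega))
  have hpos : 0 < Nat.fib n := Nat.fib_pos.2 (by omega)
  induction p using Nat.strong_induction_on with
  | _ p ih =>
    rcases Nat.eq_zero_or_pos p with rfl | hp
    · exact ⟨0, le_rfl, by omega, rfl⟩
    rcases lt_or_ge p (Nat.fib n) with h | h
    · exact ⟨Nat.fib n, h.le, by omega, h0 n le_rfl⟩
    · have hm := Nat.le_greatestFib.2 h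
      have h1 := Nat.fib_greatestFib_le p
      have h2 := Nat.lt_fib_greatestFib_add_one p
      generalize p.greatestFib = m at hm h1 h2
      obtain ⟨j, rfl⟩ := Nat.exists_eq_add_of_le h1
      have h4 : Nat.fib n ≤ Nat.fib m := Nat.fib_mono hm
      have h3 : Nat.fib (m + 1) = Nat.fib m + Nat.fib (m - 1) := fib_eq_add (n := m + 1) (by omega)
      obtain ⟨q, hq1, hq2, hq3⟩ := ih j (by omega)
      -- A zero at q < F_{m-1} is copied to F_m + q. Otherwise q has passed F_{m-1}, and the zero at
      -- F_{m+1} = F_m + F_{m-1} is already close enough.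
      rcases lt_or_ge q (Nat.fib (m - 1)) with h | h
      · exact ⟨Nat.fib m + q, by omega, by omega, by rw [hC.fib_add hn hm h, hq3]⟩
      · exact ⟨Nat.fib (m + 1), by omega, by omega, h0 _ (by omega)⟩

/-- The common properties of the substitution `eta n` and of the block substitution. -/
structure IsReshaped (C : ℕ → Fin (Nat.fib n)) (η : Fin (Nat.fib n) → List (Fin (Nat.fib n))) :
    Prop where
  isSubstitution : IsSubstitution η
  flatMap_short : (factor C (Nat.fib (n - 1)) 0).flatMap η = factor C (Nat.fib n) 0
  flatMap_long : (factor C (Nat.fib (n - 2)) (Nat.fib (n - 1))).flatMap η =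
    factor C (Nat.fib (n - 1)) 0
  apply_zero : ∃ t, t ≠ [] ∧ η (C 0) = C 0 :: t

variable {η : Fin (Nat.fib n) → List (Fin (Nat.fib n))}

/-- The Fibonacci recursion of C has order two, so the induction carries two consecutive lengths. In
the base case the prefix of length F_{n+1} is the image of the two blocks together. -/
theorem IsReshaped.flatMap_factor (hη : IsReshaped C η) (hC : IsFibCoding n C) (hn : 3 ≤ n)
    {m : ℕ} (hm : n - 1 ≤ m) :
    (factor C (Nat.fib m) 0).flatMap η = factor C (Nat.fib (m + 1)) 0 := by
  have key : ∀ m, n - 1 ≤ m → (factor C (Nat.fib m) 0).flatMap η = factor C (Nat.fib (m + 1)) 0 ∧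
      (factor C (Nat.fib (m + 1)) 0).flatMap η = factor C (Nat.fib (m + 2)) 0 := by
    intro m hm
    induction m, hm using Nat.le_induction with
    | base =>
      rw [show n - 1 + 1 = n by omega, show n - 1 + 2 = n + 1 by omega]
      refine ⟨hη.flatMap_short, ?_⟩
      rw [hC.factor_fib_succ (by omega) le_rfl, ← hη.flatMap_long]
      nth_rw 2 [← hη.flatMap_short]
      rw [← List.flatMap_append]
      rw [factor_fib_eq_append C (by omega)]
    | succ m hm ih =>
      refine ⟨ih.2, ?_⟩
      rw [hC.factor_fib_succ (by omega) (show n ≤ m + 1 by omega), List.flatMap_append, ih.2,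
        hC.factor_fib_succ (by omega) (show n ≤ m + 2 by omega)]
      simp only [Nat.add_sub_cancel, Nat.add_succ_sub_one]
      rw [ih.1]
  exact (key m hm).1

theorem IsReshaped.iter_factor (hη : IsReshaped C η) (hC : IsFibCoding n C) (hn : 3 ≤ n) (k : ℕ) :
    iter η k (factor C (Nat.fib n) 0) = factor C (Nat.fib (n + k)) 0 := by
  induction k with
  | zero => rfl
  | succ k ih => rw [iter_succ', ih, hη.flatMap_factor hC hn (by omega), add_assoc]

theorem IsReshaped.iter_mem_factors (hη : IsReshaped C η) (hC : IsFibCoding n C) (hn : 3 ≤ n)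
    (k : ℕ) (a : Fin (Nat.fib n)) : iter η k [a] ∈ factors C := by
  have h : [a] <:+: factor C (Nat.fib n) 0 := by
    rw [List.singleton_infix_iff, mem_factor]
    exact ⟨a, a.2, by simp [hC.apply_fin]⟩
  refine mem_factors_of_infix (iter_infix η k h) ?_
  rw [hη.iter_factor hC hn]
  exact factor_mem_factors _ _ _

theorem IsReshaped.lt_length_iter_zero (hη : IsReshaped C η) (k : ℕ) :
    k < (iter η k [C 0]).length := by
  obtain ⟨t, ht, h0⟩ := hη.apply_zero
  induction k with
  | zero => simp [iter_zero]
  | succ k ih =>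
    have h1 := length_le_length_iter hη.isSubstitution k t
    have h2 := List.length_pos_of_ne_nil ht
    rw [iter_succ, List.flatMap_singleton, h0, ← List.singleton_append, iter_append,
      List.length_append]
    omega

/-- The iterates of the letter 0 are prefixes of C, and each application adds at least one letter; C
is the fixed point they converge to. -/
theorem IsReshaped.factor_prefix_iter_zero (hη : IsReshaped C η) (hC : IsFibCoding n C)
    (hn : 3 ≤ n) {k l : ℕ} (hl : l ≤ k) : factor C l 0 <+: iter η k [C 0] := by
  have h0 : [C 0] <+: factor C (Nat.fib n) 0 :=
    factor_prefix C (l := 1) 0 (Nat.fib_pos.2 (by omega))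
  obtain ⟨t, ht⟩ := h0
  have h1 := hη.lt_length_iter_zero k
  have h2 : iter η k [C 0] <+: factor C (Nat.fib (n + k)) 0 := by
    rw [← hη.iter_factor hC hn, ← ht, iter_append]
    exact List.prefix_append _ _
  have h3 := h2.length_le
  rw [length_factor] at h3
  exact List.prefix_of_prefix_length_le (factor_prefix C 0 (by omega)) h2
    (by rw [length_factor]; omega)

theorem IsReshaped.language_eq (hη : IsReshaped C η) (hC : IsFibCoding n C) (hn : 3 ≤ n) :
    language η = factors C :=
  language_eq_factors (hη.iter_mem_factors hC hn) fun l =>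
    ⟨l, C 0, (hη.factor_prefix_iter_zero hC hn le_rfl).isInfix⟩

theorem IsReshaped.mem_iter_zero (hη : IsReshaped C η) (hC : IsFibCoding n C) (hn : 3 ≤ n)
    {k : ℕ} (hk : Nat.fib n ≤ k) (a : Fin (Nat.fib n)) : a ∈ iter η k [C 0] :=
  (hη.factor_prefix_iter_zero hC hn hk).subset
    (mem_factor.2 ⟨a, a.2, by simp [hC.apply_fin]⟩)

theorem language_fibSubst : language fibSubst = factors fibWord := by
  have h0 : ∀ k, iter fibSubst k [0] ∈ factors fibWord := fun k => by
    rw [iter_fibSubst_eq_factor]; exact factor_mem_factors _ _ _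
  refine language_eq_factors (fun k a => ?_) fun l => ⟨l, 0, ?_⟩
  · fin_cases a
    · exact h0 k
    · cases k with
      | zero => exact ⟨1, by decide⟩
      | succ k => exact h0 k
  · rw [iter_fibSubst_eq_factor]
    refine (factor_prefix _ _ ?_).isInfix
    have := Nat.le_fib_add_one (l + 2)
    omega

end Coding

/-! ### Conjugacy with the higher block presentation. -/

section Conjugacy

variable {A B : Type}

theorem window_eq_factor_iff {x : ℤ → A} {u : ℕ → A} {i : ℤ} {l p : ℕ} :
    window x i l = factor u l p ↔ ∀ j < l, x (i + (j : ℕ)) = u (p + j) := by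
  rw [List.ext_getElem_iff]
  simp +contextual [window]

theorem window_mem_factors_iff {x : ℤ → A} {u : ℕ → A} {i : ℤ} {l : ℕ} :
    window x i l ∈ factors u ↔ ∃ p, window x i l = factor u l p := by
  simp [factors, window]

theorem mem_systemSet {η : A → List A} {u : ℕ → A} (hη : language η = factors u) {x : ℤ → A} :
    x ∈ systemSet η ↔ ∀ (i : ℤ) (l : ℕ), ∃ p, ∀ j < l, x (i + (j : ℕ)) = u (p + j) := by
  simp only [systemSet, hη, Set.mem_ofPred_eq, window_mem_factors_iff, window_eq_factor_iff]

/-- The higher block presentation of a substitution system is conjugate to it. -/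
theorem conjugate_of_factor_eq_iff [TopologicalSpace A] [DiscreteTopology A] [TopologicalSpace B]
    [DiscreteTopology B] {η : A → List A} {θ : B → List B} {u : ℕ → A} {C : ℕ → B} {N : ℕ}
    (hN : 0 < N) (hη : language η = factors u) (hθ : language θ = factors C)
    (h : ∀ p q, C p = C q ↔ factor u N p = factor u N q) :
    Conjugate (system η) (system θ) := by
  -- The sliding block code and its inverse, which reads the first letter of the coded block. The
  -- default values never matter, since only factors of u and letters of C are fed in.
  let d : List A → B := Function.extend (factor u N) C fun _ => C 0
  have hd : ∀ p, d (factor u N p) = C p := fun p =>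
    Function.FactorsThrough.extend_apply (fun p q hpq => (h p q).2 hpq) _ p
  let e : B → A := Function.extend C u fun _ => u 0
  have he : ∀ p, e (C p) = u p := fun p =>
    Function.FactorsThrough.extend_apply (fun p q hpq => by
      simpa using factor_eq_factor.1 ((h p q).1 hpq) 0 hN) _ p
  have hf : ∀ (x : ℤ → A) (i : ℤ) (p : ℕ), (∀ j < N, x (i + (j : ℕ)) = u (p + j)) →
      d (window x i N) = C p := fun x i p hx => by
    rw [window_eq_factor_iff.2 hx, hd]
  have hto : ∀ x ∈ systemSet η, (fun i => d (window x i N)) ∈ systemSet θ := by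
    intro x hx
    rw [mem_systemSet hη] at hx
    rw [mem_systemSet hθ]
    intro i l
    -- All l windows of length N starting at i, ..., i + l - 1 lie in this one window.
    obtain ⟨p, hp⟩ := hx i (l + N)
    refine ⟨p, fun j hj => hf _ _ _ fun k hk => ?_⟩
    have := hp (j + k) (by omega)
    push_cast at this
    rwa [← add_assoc, ← add_assoc] at this
  have hinv : ∀ y ∈ systemSet θ, (fun i => e (y i)) ∈ systemSet η := by
    intro y hy
    rw [mem_systemSet hθ] at hy
    rw [mem_systemSet hη]
    intro i l
    obtain ⟨p, hp⟩ := hy i l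
    exact ⟨p, fun j hj => by rw [hp j hj, he]⟩
  refine ⟨{ toFun := fun x => ⟨fun i => d (window x.1 i N), hto _ x.2⟩
            invFun := fun y => ⟨fun i => e (y.1 i), hinv _ y.2⟩
            left_inv := ?_
            right_inv := ?_
            continuous_toFun := ?_
            continuous_invFun := ?_ }, ?_⟩
  · intro x
    refine Subtype.ext (funext fun i => ?_)
    obtain ⟨p, hp⟩ := (mem_systemSet hη).1 x.2 i N
    have h0 := hp 0 hN
    simp only [Nat.cast_zero, add_zero] at h0
    change e (d (window x.1 i N)) = x.1 i
    rw [hf _ _ _ hp, he, h0]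
  · intro y
    refine Subtype.ext (funext fun i => ?_)
    obtain ⟨p, hp⟩ := (mem_systemSet hθ).1 y.2 i N
    have h0 := hp 0 hN
    simp only [Nat.cast_zero, add_zero] at h0
    change d (window (fun i => e (y.1 i)) i N) = y.1 i
    rw [hf _ _ p fun j hj => by rw [hp j hj, he], h0]
  · refine Continuous.subtype_mk (continuous_pi fun i => ?_) _
    have h1 : Continuous fun (x : systemSet η) (j : Fin N) => x.1 (i + (j : ℕ)) :=
      continuous_pi fun j => (continuous_apply _).comp continuous_subtype_val
    exact (continuous_of_discreteTopology (f := fun w : Fin N → A => d (List.ofFn w))).comp h1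
  · refine Continuous.subtype_mk (continuous_pi fun i => ?_) _
    exact (continuous_of_discreteTopology (f := e)).comp
      ((continuous_apply i).comp continuous_subtype_val)
  · intro x
    refine Subtype.ext (funext fun i => ?_)
    change d (List.ofFn fun j : Fin N => x.1 (1 + (i + (j : ℕ)))) =
      d (List.ofFn fun j : Fin N => x.1 (1 + i + (j : ℕ)))
    simp only [add_assoc]

theorem IsReshaped.conjugate {n : ℕ} {C : ℕ → Fin (Nat.fib n)}
    {η : Fin (Nat.fib n) → List (Fin (Nat.fib n))} (hη : IsReshaped C η) (hC : IsFibCoding n C)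
    (hn : 3 ≤ n) : Conjugate (system fibSubst) (system η) := by
  have h : Nat.fib 3 ≤ Nat.fib n := Nat.fib_mono hn
  rw [show Nat.fib 3 = 2 from rfl] at h
  exact conjugate_of_factor_eq_iff (N := Nat.fib n - 1) (by omega) language_fibSubst
    (hη.language_eq hC hn) fun p q => hC.eq_iff

end Conjugacy

/-! ### Incidence matrices, primitivity and the Perron–Frobenius eigenvalue. -/

section Incidence

variable {A : Type} [Fintype A] [DecidableEq A]

theorem count_flatMap_eq_sum (η : A → List A) (w : List A) (b : A) :
    (w.flatMap η).count b = ∑ c, w.count c * (η c).count b := by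
  induction w with
  | nil => simp
  | cons a w ih => simp [List.count_cons, ih, add_mul, Finset.sum_add_distrib, add_comm]

theorem incidence_pow_apply (η : A → List A) (k : ℕ) (a b : A) :
    (incidence η ^ k) a b = ((iter η k [a]).count b : ℝ) := by
  induction k generalizing b with
  | zero => simp [iter_zero, Matrix.one_apply, List.count_singleton]
  | succ k ih =>
    rw [pow_succ, Matrix.mul_apply, iter_succ', count_flatMap_eq_sum]
    push_cast
    exact Finset.sum_congr rfl fun c _ => congrArg (· * _) (ih c)

theorem isPrimitive_incidence {η : A → List A}
    (h : ∀ a, ∀ᶠ k in Filter.atTop, ∀ b, b ∈ iter η k [a]) : (incidence η).IsPrimitive := by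
  refine ⟨fun i j => by simp [incidence], ?_⟩
  obtain ⟨k, hk, hk'⟩ := ((Filter.eventually_gt_atTop 0).and (Filter.eventually_all.2 h)).exists
  refine ⟨k, hk, fun i j => ?_⟩
  rw [incidence_pow_apply]
  exact_mod_cast List.count_pos_iff.2 (hk' i j)

theorem incidence_mulVec (η : A → List A) (x : A → ℝ) (a : A) :
    (incidence η).mulVec x a = ((η a).map x).sum := by
  rw [Finset.sum_list_map_count]
  simp only [Matrix.mulVec, dotProduct, incidence, Matrix.of_apply, nsmul_eq_mul]
  refine (Finset.sum_subset (Finset.subset_univ _) fun b _ hb => ?_).symm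
  rw [List.mem_toFinset] at hb
  simp [List.count_eq_zero_of_not_mem hb]

/-- A positive left eigenvector of a nonnegative matrix belongs to the Perron-Frobenius
eigenvalue. -/
theorem isPerronFrobeniusEigenvalue_of_vecMul [Nonempty A] {M : Matrix A A ℝ}
    (hM : ∀ i j, 0 ≤ M i j) {l : ℝ} (hl : 0 ≤ l) {u : A → ℝ} (hu : ∀ i, 0 < u i)
    (h : Matrix.vecMul u M = l • u) : IsPerronFrobeniusEigenvalue M l := by
  refine ⟨hl, ?_, fun z hz => ?_⟩
  -- A singular matrix has kernels on both sides, so the left eigenvector yields a right one.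
  · have h1 : (M - l • (1 : Matrix A A ℝ)).det = 0 := by
      rw [← Matrix.exists_vecMul_eq_zero_iff]
      refine ⟨u, fun h0 => ?_, ?_⟩
      · obtain ⟨i⟩ := ‹Nonempty A›
        exact (hu i).ne' (congrFun h0 i)
      · rw [Matrix.vecMul_sub, h, Matrix.vecMul_smul, Matrix.vecMul_one, sub_self]
    obtain ⟨v, hv, hv'⟩ := Matrix.exists_mulVec_eq_zero_iff.2 h1
    refine Module.End.hasEigenvalue_of_hasEigenvector (x := v)
      (Module.End.hasEigenvector_iff.2 ⟨Module.End.mem_eigenspace_iff.2 ?_, hv⟩)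
    rw [Matrix.sub_mulVec, Matrix.smul_mulVec, Matrix.one_mulVec, sub_eq_zero] at hv'
    rw [Matrix.toLin'_apply, hv']
  · obtain ⟨x, hx⟩ := hz.exists_hasEigenvector
    have h1 : ∀ i, ∑ j, (M i j : ℂ) * x j = z * x i := fun i => by
      have := congrFun hx.apply_eq_smul i
      simpa [Matrix.mulVec, dotProduct] using this
    have h2 : ∀ i, ‖z‖ * ‖x i‖ ≤ ∑ j, M i j * ‖x j‖ := fun i => by
      rw [← norm_mul, ← h1 i]
      refine (norm_sum_le _ _).trans (Finset.sum_le_sum fun j _ => ?_)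
      rw [norm_mul, Complex.norm_real, Real.norm_of_nonneg (hM i j)]
    -- Pairing the entrywise inequality for |x| with the positive left eigenvector u turns M into l;
    -- the pairing is positive and can be cancelled.
    have h3 : ‖z‖ * ∑ i, u i * ‖x i‖ ≤ l * ∑ i, u i * ‖x i‖ := by
      calc ‖z‖ * ∑ i, u i * ‖x i‖ = ∑ i, u i * (‖z‖ * ‖x i‖) := by
            rw [Finset.mul_sum]; exact Finset.sum_congr rfl fun i _ => by ring
        _ ≤ ∑ i, u i * ∑ j, M i j * ‖x j‖ :=
            Finset.sum_le_sum fun i _ => mul_le_mul_of_nonneg_left (h2 i) (hu i).le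
        _ = ∑ j, (∑ i, u i * M i j) * ‖x j‖ := by
            simp only [Finset.mul_sum, Finset.sum_mul]
            rw [Finset.sum_comm]
            exact Finset.sum_congr rfl fun j _ => Finset.sum_congr rfl fun i _ => by ring
        _ = ∑ j, l * u j * ‖x j‖ := Finset.sum_congr rfl fun j _ => by
            have := congrFun h j
            simp only [Matrix.vecMul, dotProduct, Pi.smul_apply, smul_eq_mul] at this
            rw [this]
        _ = l * ∑ i, u i * ‖x i‖ := by
            rw [Finset.mul_sum]; exact Finset.sum_congr rfl fun i _ => by ring
    obtain ⟨i, hi⟩ := Function.ne_iff.1 hx.2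
    refine le_of_mul_le_mul_right h3 (Finset.sum_pos' (fun i _ => by have := hu i; positivity)
      ⟨i, Finset.mem_univ i, mul_pos (hu i) (norm_pos_iff.2 hi)⟩)

end Incidence

/-! ### Eigenvalue and primitivity, independent of the cutting. -/

section Reshaped

variable {n : ℕ} {C : ℕ → Fin (Nat.fib n)} {η : Fin (Nat.fib n) → List (Fin (Nat.fib n))}

theorem IsFibCoding.nodup_factor (hC : IsFibCoding n C) : (factor C (Nat.fib n) 0).Nodup := by
  have h := hC.interval_eq (lo := 0) le_rfl
  rw [Nat.sub_zero] at h
  rw [← h]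
  exact (List.nodup_finRange _).filter _

theorem IsFibCoding.mem_factor (hC : IsFibCoding n C) (a : Fin (Nat.fib n)) :
    a ∈ factor C (Nat.fib n) 0 :=
  Substitutions.mem_factor.2 ⟨a, a.2, by rw [zero_add, hC.apply_fin]⟩

theorem IsFibCoding.count_factor (hC : IsFibCoding n C) (a : Fin (Nat.fib n)) :
    (factor C (Nat.fib n) 0).count a = 1 :=
  List.count_eq_one_of_mem hC.nodup_factor (hC.mem_factor a)

/-- As row vectors, the letter counts satisfy w₁M = w₁ + w₂ and w₂M = w₁, so Φw₁ + w₂ is a left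
eigenvector for Φ by Φ² = Φ + 1. It is positive because each letter lies in exactly one block. -/
theorem IsReshaped.isPerronFrobeniusEigenvalue (hη : IsReshaped C η) (hC : IsFibCoding n C)
    (hn : 3 ≤ n) : IsPerronFrobeniusEigenvalue (incidence η) Real.goldenRatio := by
  have hpos : 0 < Nat.fib n := Nat.fib_pos.2 (by omega)
  have : Nonempty (Fin (Nat.fib n)) := ⟨⟨0, hpos⟩⟩
  set w₁ := factor C (Nat.fib (n - 1)) 0 with hw₁
  set w₂ := factor C (Nat.fib (n - 2)) (Nat.fib (n - 1)) with hw₂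
  have h1 : ∀ a, (w₁.count a : ℝ) + w₂.count a = 1 := fun a => by
    have := hC.count_factor a
    rw [factor_fib_eq_append C (by omega), List.count_append] at this
    exact_mod_cast this
  refine isPerronFrobeniusEigenvalue_of_vecMul (fun i j => by simp [incidence])
    Real.goldenRatio_pos.le
    (u := fun a => Real.goldenRatio * w₁.count a + w₂.count a) (fun a => ?_) (funext fun b => ?_)
  · have h2 := mul_le_mul_of_nonneg_right Real.one_lt_goldenRatio.le
      (Nat.cast_nonneg (α := ℝ) (w₁.count a))
    have h3 := h1 a
    linarith
  · have h2 : ∀ w : List (Fin (Nat.fib n)),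
        ∑ a, (w.count a : ℝ) * (η a).count b = (w.flatMap η).count b := fun w => by
      rw [count_flatMap_eq_sum]; push_cast; rfl
    have h3 : ((factor C (Nat.fib n) 0).count b : ℝ) = 1 := by exact_mod_cast hC.count_factor b
    calc ∑ a, (Real.goldenRatio * w₁.count a + w₂.count a) * incidence η a b =
          Real.goldenRatio * ∑ a, (w₁.count a : ℝ) * (η a).count b +
          ∑ a, (w₂.count a : ℝ) * (η a).count b := by
          rw [Finset.mul_sum, ← Finset.sum_add_distrib]
          refine Finset.sum_congr rfl fun a _ => ?_
          simp only [incidence, Matrix.of_apply]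
          ring
      _ = Real.goldenRatio * (w₁.count b + w₂.count b) + w₁.count b := by
          rw [h2, h2, hη.flatMap_short, hη.flatMap_long, h3, h1]
      _ = _ := by
          simp only [Pi.smul_apply, smul_eq_mul]
          linear_combination -(w₁.count b : ℝ) * Real.goldenRatio_sq

theorem IsReshaped.eventually_mem_iter (hη : IsReshaped C η) (hC : IsFibCoding n C)
    (hn : 3 ≤ n) {a : Fin (Nat.fib n)} {k : ℕ} (h : C 0 ∈ iter η k [a]) :
    ∀ᶠ m in Filter.atTop, ∀ b, b ∈ iter η m [a] := by
  rw [Filter.eventually_atTop]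
  refine ⟨Nat.fib n + k, fun m hm b => ?_⟩
  rw [← Nat.sub_add_cancel (show k ≤ m by omega), iter_add]
  exact (iter_infix η _ ((List.singleton_infix_iff _ _).2 h)).subset
    (hη.mem_iter_zero hC hn (by omega) b)

/-- Iterating until the first letter of the current word splits gains a letter, while the rest of
the word never shrinks. -/
theorem exists_length_iter_gt {A : Type} {η : A → List A} (hη : IsSubstitution η)
    (h : ∀ a, ∃ k, 2 ≤ (iter η k [a]).length) (a : A) (l : ℕ) :
    ∃ k, l < (iter η k [a]).length := by
  induction l with
  | zero => exact ⟨0, by simp [iter_zero]⟩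
  | succ l ih =>
    obtain ⟨k, hk⟩ := ih
    obtain ⟨b, t, hbt⟩ := List.exists_cons_of_length_pos (by omega : 0 < (iter η k [a]).length)
    obtain ⟨m, hm⟩ := h b
    refine ⟨m + k, ?_⟩
    have := length_le_length_iter hη m t
    rw [hbt, List.length_cons] at hk
    rw [iter_add, hbt, ← List.singleton_append, iter_append, List.length_append]
    omega

/-- Growth suffices: an iterate of a longer than F_n is a factor of C, so it contains 0 by the
bounded gaps, and the iterates of 0 eventually contain every letter. -/
theorem IsReshaped.isPrimitive (hη : IsReshaped C η) (hC : IsFibCoding n C) (hn : 3 ≤ n)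
    (h : ∀ a, ∃ k, 2 ≤ (iter η k [a]).length) : (incidence η).IsPrimitive := by
  refine isPrimitive_incidence fun a => ?_
  obtain ⟨k, hk⟩ := exists_length_iter_gt hη.isSubstitution h a (Nat.fib n)
  refine hη.eventually_mem_iter hC hn (k := k) ?_
  obtain ⟨p, hp⟩ := hη.iter_mem_factors hC hn k a
  obtain ⟨q, h1, h2, h3⟩ := hC.exists_zero (by omega) p
  rw [hp, mem_factor]
  exact ⟨q - p, by omega, by rw [Nat.add_sub_cancel' h1, h3]⟩

end Reshaped

/-! ### Substitutions given by two interval partitions: injectivity and full rank from the cuts. -/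

section IntervalSubst

/-- `η` maps the letters of `S` and of `L` to consecutive intervals, with cuts at the values of `h`
and of `h'` respectively. -/
structure IsIntervalSubst (n : ℕ) (h h' : ℕ → ℕ)
    (η : Fin (Nat.fib n) → List (Fin (Nat.fib n))) : Prop where
  apply_short : ∀ a : Fin (Nat.fib n), (a : ℕ) < Nat.fib (n - 1) →
    η a = interval _ (h a) (h (a + 1))
  apply_long : ∀ a : Fin (Nat.fib n), Nat.fib (n - 1) ≤ (a : ℕ) →
    η a = interval _ (h' (a - Nat.fib (n - 1))) (h' (a - Nat.fib (n - 1) + 1))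
  short_lt : ∀ a < Nat.fib (n - 1), h a < h (a + 1)
  long_lt : ∀ k < Nat.fib (n - 2), h' k < h' (k + 1)
  short_zero : h 0 = 0
  long_zero : h' 0 = 0
  short_last : h (Nat.fib (n - 1)) = Nat.fib n
  long_last : h' (Nat.fib (n - 2)) = Nat.fib (n - 1)
  two_le : 2 ≤ h 1

theorem factor_append_factor_sub {A : Type} (u : ℕ → A) {p q : ℕ} (h : p ≤ q) :
    factor u p 0 ++ factor u (q - p) p = factor u q 0 := by
  obtain ⟨l, rfl⟩ := Nat.exists_eq_add_of_le h
  rw [factor_add, zero_add, Nat.add_sub_cancel_left]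

/-- The inequality b - a ≤ f b - f a, written without truncated subtraction. -/
theorem add_le_add_of_lt_succ {f : ℕ → ℕ} {K : ℕ} (hf : ∀ a < K, f a < f (a + 1)) {a b : ℕ}
    (hab : a ≤ b) (hb : b ≤ K) : f a + b ≤ f b + a := by
  induction b, hab using Nat.le_induction with
  | base => rfl
  | succ b hab ih =>
    have := hf b hb
    have := ih (by omega)
    omega

theorem eq_of_lt_succ {f : ℕ → ℕ} {K : ℕ} (hf : ∀ a < K, f a < f (a + 1)) {a b : ℕ}
    (ha : a ≤ K) (hb : b ≤ K) (h : f a = f b) : a = b := by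
  rcases le_total a b with hab | hab
  · have := add_le_add_of_lt_succ hf hab hb
    omega
  · have := add_le_add_of_lt_succ hf hab ha
    omega

variable {n : ℕ} {h h' : ℕ → ℕ} {C : ℕ → Fin (Nat.fib n)}
  {η : Fin (Nat.fib n) → List (Fin (Nat.fib n))}

theorem IsIntervalSubst.short_le (hη : IsIntervalSubst n h h' η) {a : ℕ}
    (ha : a ≤ Nat.fib (n - 1)) : h a ≤ Nat.fib n := by
  have := add_le_add_of_lt_succ hη.short_lt ha le_rfl
  rw [hη.short_last] at this
  omega

theorem IsIntervalSubst.long_le (hη : IsIntervalSubst n h h' η) {k : ℕ}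
    (hk : k ≤ Nat.fib (n - 2)) : h' k ≤ Nat.fib (n - 1) := by
  have := add_le_add_of_lt_succ hη.long_lt hk le_rfl
  rw [hη.long_last] at this
  omega

theorem IsIntervalSubst.apply_short_eq (hη : IsIntervalSubst n h h' η) (hC : IsFibCoding n C)
    {a : ℕ} (ha : a < Nat.fib (n - 1)) : η (C a) = factor C (h (a + 1) - h a) (h a) := by
  have h1 : Nat.fib (n - 1) ≤ Nat.fib n := Nat.fib_mono (by omega)
  have h2 := hC.val_apply (show a < Nat.fib n by omega)
  rw [hη.apply_short _ (by omega), h2, hC.interval_eq (hη.short_le ha)]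

theorem IsIntervalSubst.apply_long_eq (hη : IsIntervalSubst n h h' η) (hC : IsFibCoding n C)
    (hn : 2 ≤ n) {k : ℕ} (hk : k < Nat.fib (n - 2)) :
    η (C (Nat.fib (n - 1) + k)) = factor C (h' (k + 1) - h' k) (h' k) := by
  have h1 := fib_eq_add hn
  have h2 := hC.val_apply (show Nat.fib (n - 1) + k < Nat.fib n by omega)
  have h3 := hη.long_le (show k + 1 ≤ Nat.fib (n - 2) by omega)
  rw [hη.apply_long _ (by omega), h2, Nat.add_sub_cancel_left, hC.interval_eq (by omega)]

theorem IsFibCoding.forall_iff (hC : IsFibCoding n C) (hn : 2 ≤ n)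
    {P : Fin (Nat.fib n) → Prop} : (∀ a, P a) ↔
      (∀ a < Nat.fib (n - 1), P (C a)) ∧ ∀ k < Nat.fib (n - 2), P (C (Nat.fib (n - 1) + k)) := by
  refine ⟨fun hP => ⟨fun _ _ => hP _, fun _ _ => hP _⟩, fun hP a => ?_⟩
  have h1 := fib_eq_add hn
  rw [← hC.apply_fin a]
  rcases lt_or_ge (a : ℕ) (Nat.fib (n - 1)) with ha | ha
  · exact hP.1 a ha
  · have := hP.2 (a - Nat.fib (n - 1)) (by omega)
    rwa [Nat.add_sub_cancel' ha] at this

theorem IsIntervalSubst.isReshaped (hη : IsIntervalSubst n h h' η) (hC : IsFibCoding n C)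
    (hn : 2 ≤ n) : IsReshaped C η where
  isSubstitution := by
    refine (hC.forall_iff hn).2 ⟨fun a ha => ?_, fun k hk => ?_⟩
    · have := hη.short_lt a ha
      rw [hη.apply_short_eq hC ha, ← List.length_pos_iff, length_factor]
      omega
    · have := hη.long_lt k hk
      rw [hη.apply_long_eq hC hn hk, ← List.length_pos_iff, length_factor]
      omega
  flatMap_short := by
    have key : ∀ m ≤ Nat.fib (n - 1), (factor C m 0).flatMap η = factor C (h m) 0 := by
      intro m hm
      induction m with
      | zero => rw [hη.short_zero]; rfl
      | succ m ih =>
        have := hη.short_lt m hm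
        rw [factor_add, List.flatMap_append, ih (by omega),
          show factor C 1 (0 + m) = [C m] by simp [factor], List.flatMap_singleton,
          hη.apply_short_eq hC hm]
        exact factor_append_factor_sub C this.le
    rw [key _ le_rfl, hη.short_last]
  flatMap_long := by
    have key : ∀ m ≤ Nat.fib (n - 2),
        (factor C m (Nat.fib (n - 1))).flatMap η = factor C (h' m) 0 := by
      intro m hm
      induction m with
      | zero => rw [hη.long_zero]; rfl
      | succ m ih =>
        have := hη.long_lt m hm
        rw [factor_add, List.flatMap_append, ih (by omega),
          show factor C 1 (Nat.fib (n - 1) + m) = [C (Nat.fib (n - 1) + m)] by simp [factor],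
          List.flatMap_singleton, hη.apply_long_eq hC hn hm]
        exact factor_append_factor_sub C this.le
    rw [key _ le_rfl, hη.long_last]
  apply_zero := by
    have h2 := hη.two_le
    refine ⟨factor C (h 1 - 1) 1, ?_, ?_⟩
    · rw [← List.length_pos_iff, length_factor]
      omega
    · rw [hη.apply_short_eq hC (Nat.fib_pos.2 (by omega)), hη.short_zero,
        show h (0 + 1) - 0 = (h 1 - 1) + 1 by rw [zero_add]; omega, factor_succ]

theorem IsFibCoding.apply_inj (hC : IsFibCoding n C) {p q : ℕ} (hp : p < Nat.fib n)
    (hq : q < Nat.fib n) (h : C p = C q) : p = q := by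
  rw [← hC.val_apply hp, ← hC.val_apply hq, h]

theorem eq_of_factor_eq_factor (hC : IsFibCoding n C) {l m p q : ℕ} (hl : 0 < l)
    (hp : p < Nat.fib n) (hq : q < Nat.fib n) (h : factor C l p = factor C m q) :
    p = q ∧ l = m := by
  obtain rfl : l = m := by simpa using congrArg List.length h
  exact ⟨hC.apply_inj hp hq (by simpa using factor_eq_factor.1 h 0 hl), rfl⟩

/-- An image is a nonempty interval of distinct letters and so determines both its ends. Within one
partition the left end determines the letter; across the two, `hne` forbids equal ends. -/
theorem IsIntervalSubst.injective (hη : IsIntervalSubst n h h' η) (hC : IsFibCoding n C)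
    (hn : 2 ≤ n) (hne : ∀ a < Nat.fib (n - 1), ∀ k < Nat.fib (n - 2), h a = h' k →
      h (a + 1) ≠ h' (k + 1)) : Function.Injective η := by
  have hs : ∀ a < Nat.fib (n - 1), h a < Nat.fib n := fun a ha =>
    (hη.short_lt a ha).trans_le (hη.short_le ha)
  have h1 : Nat.fib (n - 1) ≤ Nat.fib n := Nat.fib_mono (by omega)
  have hl : ∀ k < Nat.fib (n - 2), h' k < Nat.fib n := fun k hk =>
    ((hη.long_lt k hk).trans_le (hη.long_le hk)).trans_le h1
  have hmix : ∀ a < Nat.fib (n - 1), ∀ k < Nat.fib (n - 2),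
      η (C a) ≠ η (C (Nat.fib (n - 1) + k)) := by
    intro a ha k hk he
    have h2 := hη.short_lt a ha
    have h3 := hη.long_lt k hk
    rw [hη.apply_short_eq hC ha, hη.apply_long_eq hC hn hk] at he
    obtain ⟨h4, h5⟩ := eq_of_factor_eq_factor hC (by omega) (hs a ha) (hl k hk) he
    exact hne a ha k hk h4 (by omega)
  unfold Function.Injective
  refine (hC.forall_iff hn).2 ⟨fun a ha => (hC.forall_iff hn).2 ⟨fun b hb he => ?_,
    fun k hk he => (hmix a ha k hk he).elim⟩, fun k hk => (hC.forall_iff hn).2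
      ⟨fun a ha he => (hmix a ha k hk he.symm).elim, fun m hm he => ?_⟩⟩
  · have h2 := hη.short_lt a ha
    rw [hη.apply_short_eq hC ha, hη.apply_short_eq hC hb] at he
    have h4 := eq_of_factor_eq_factor hC (by omega) (hs a ha) (hs b hb) he
    rw [eq_of_lt_succ hη.short_lt ha.le hb.le h4.1]
  · have h2 := hη.long_lt k hk
    rw [hη.apply_long_eq hC hn hk, hη.apply_long_eq hC hn hm] at he
    have h4 := eq_of_factor_eq_factor hC (by omega) (hl k hk) (hl m hm) he
    rw [eq_of_lt_succ hη.long_lt hk.le hm.le h4.1]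

/-- A kernel vector x sums to zero over every image, so its partial sums vanish at every cut of
either partition. By `hcut` these are all positions, and the differences of the partial sums are the
entries of x. -/
theorem IsIntervalSubst.det_ne_zero (hη : IsIntervalSubst n h h' η) (hC : IsFibCoding n C)
    (hn : 2 ≤ n) (hcut : ∀ j ≤ Nat.fib n, (∃ a ≤ Nat.fib (n - 1), h a = j) ∨
      ∃ k ≤ Nat.fib (n - 2), h' k = j) : (incidence η).det ≠ 0 := by
  intro hdet
  obtain ⟨x, hx0, hx⟩ := Matrix.exists_mulVec_eq_zero_iff.2 hdet
  have hx' : ∀ a, ((η a).map x).sum = 0 := fun a => by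
    rw [← incidence_mulVec, hx]; rfl
  let P : ℕ → ℝ := fun j => ((factor C j 0).map x).sum
  have hP : ∀ p q, p ≤ q → ((factor C (q - p) p).map x).sum = 0 → P p = 0 → P q = 0 := by
    intro p q hpq h1 h2
    change ((factor C q 0).map x).sum = 0
    rw [← factor_append_factor_sub C hpq, List.map_append, List.sum_append, h1, add_zero]
    exact h2
  have hS : ∀ a ≤ Nat.fib (n - 1), P (h a) = 0 := by
    intro a ha
    induction a with
    | zero => rw [hη.short_zero]; rfl
    | succ a ih =>
      refine hP _ _ (hη.short_lt a ha).le ?_ (ih (by omega))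
      rw [← hη.apply_short_eq hC ha, hx']
  have hL : ∀ k ≤ Nat.fib (n - 2), P (h' k) = 0 := by
    intro k hk
    induction k with
    | zero => rw [hη.long_zero]; rfl
    | succ k ih =>
      refine hP _ _ (hη.long_lt k hk).le ?_ (ih (by omega))
      rw [← hη.apply_long_eq hC hn hk, hx']
  have hall : ∀ j ≤ Nat.fib n, P j = 0 := by
    intro j hj
    rcases hcut j hj with ⟨a, ha, rfl⟩ | ⟨k, hk, rfl⟩
    · exact hS a ha
    · exact hL k hk
  refine hx0 (funext fun a => ?_)
  have h1 : P (a + 1) = P a + x a := by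
    change ((factor C (a + 1) 0).map x).sum = ((factor C a 0).map x).sum + x a
    rw [factor_add, List.map_append, List.sum_append]
    simp [factor, hC.apply_fin]
  rw [hall _ a.2, hall _ a.2.le, zero_add] at h1
  exact h1.symm

end IntervalSubst

/-! ### Positions of letter images in the fixed point of the Fibonacci substitution. -/

section FibPos

/-- The length of the image of the first `k` letters of the Fibonacci word. -/
def fibPos (k : ℕ) : ℕ := ∑ i ∈ Finset.range k, (2 - (fibWord i : ℕ))

theorem fibPos_succ (k : ℕ) : fibPos (k + 1) = fibPos k + (2 - (fibWord k : ℕ)) :=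
  Finset.sum_range_succ _ _

theorem fibPos_lt_succ (k : ℕ) : fibPos k < fibPos (k + 1) := by
  rw [fibPos_succ]; omega

theorem fibPos_succ_le (k : ℕ) : fibPos (k + 1) ≤ fibPos k + 2 := by
  rw [fibPos_succ]; omega

theorem fibPos_add_sum_map (l p : ℕ) :
    fibPos p + ((factor fibWord l p).map fun c : Fin 2 => 2 - (c : ℕ)).sum = fibPos (p + l) := by
  induction l with
  | zero => rfl
  | succ l ih =>
    rw [factor_add, List.map_append, List.sum_append, ← add_assoc, ih, ← add_assoc, fibPos_succ]
    simp [factor]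

theorem length_fibSubst (a : Fin 2) : (fibSubst a).length = 2 - (a : ℕ) := by
  fin_cases a <;> rfl

theorem length_factor_flatMap (l p : ℕ) :
    fibPos p + ((factor fibWord l p).flatMap fibSubst).length = fibPos (p + l) := by
  rw [← fibPos_add_sum_map, List.length_flatMap]
  simp only [length_fibSubst]

theorem factor_fib_flatMap {m : ℕ} (hm : 2 ≤ m) :
    (factor fibWord (Nat.fib m) 0).flatMap fibSubst = factor fibWord (Nat.fib (m + 1)) 0 := by
  obtain ⟨k, rfl⟩ := Nat.exists_eq_add_of_le' hm
  rw [← iter_fibSubst_eq_factor, ← iter_succ', iter_fibSubst_eq_factor, add_right_comm]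

theorem fibPos_fib {m : ℕ} (hm : 2 ≤ m) : fibPos (Nat.fib m) = Nat.fib (m + 1) := by
  have h := length_factor_flatMap (Nat.fib m) 0
  rw [factor_fib_flatMap hm, length_factor] at h
  simpa [fibPos] using h.symm

theorem factor_zero_flatMap (k : ℕ) :
    (factor fibWord k 0).flatMap fibSubst = factor fibWord (fibPos k) 0 := by
  obtain ⟨m, hm, hk⟩ : ∃ m, 2 ≤ m ∧ k ≤ Nat.fib m :=
    ⟨k + 5, by omega, by have := Nat.le_fib_self (n := k + 5) (by omega); omega⟩
  have h1 := length_factor_flatMap k 0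
  obtain ⟨t, ht⟩ := factor_prefix fibWord 0 hk
  have h2 : (factor fibWord k 0).flatMap fibSubst <+: factor fibWord (Nat.fib (m + 1)) 0 := by
    rw [← factor_fib_flatMap hm, ← ht, List.flatMap_append]
    exact List.prefix_append _ _
  have h3 := h2.length_le
  rw [length_factor] at h3
  rw [List.prefix_iff_eq_take.1 h2, take_factor _ _ _ _ h3]
  rw [zero_add, show fibPos 0 = 0 from rfl, zero_add] at h1
  rw [h1]

theorem factor_flatMap (l p : ℕ) : (factor fibWord l p).flatMap fibSubst =
    factor fibWord (fibPos (p + l) - fibPos p) (fibPos p) := by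
  have h1 := length_factor_flatMap l p
  have h2 := factor_zero_flatMap (p + l)
  rw [factor_add, List.flatMap_append, factor_zero_flatMap, zero_add,
    ← factor_append_factor_sub fibWord (show fibPos p ≤ fibPos (p + l) by omega)] at h2
  exact List.append_cancel_left h2

end FibPos

/-! ### The block substitution as an interval substitution. -/

section Block

/-- The block substitution of the Fibonacci substitution in the coding of the words of length
`F_n - 1` by their first position. -/
def fibBlockSubst (n : ℕ) (a : Fin (Nat.fib n)) : List (Fin (Nat.fib n)) :=
  if (a : ℕ) < Nat.fib (n - 1) then interval _ (fibPos a) (fibPos (a + 1))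
  -- These images lie at positions from F_n on in C, where C repeats its prefix of length F_{n-1};
  -- hence the shift by F_n.
  else interval _ (fibPos a - Nat.fib n) (fibPos (a + 1) - Nat.fib n)

theorem isIntervalSubst_fibBlockSubst {n : ℕ} (hn : 3 ≤ n) :
    IsIntervalSubst n fibPos (fun k => fibPos (Nat.fib (n - 1) + k) - Nat.fib n)
      (fibBlockSubst n) := by
  have h1 := fib_eq_add (n := n) (by omega)
  have h2 : Nat.fib (n + 1) = Nat.fib n + Nat.fib (n - 1) := fib_eq_add (n := n + 1) (by omega)
  have h3 : fibPos (Nat.fib (n - 1)) = Nat.fib n := by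
    rw [fibPos_fib (by omega), Nat.sub_add_cancel (by omega)]
  have h4 := fibPos_fib (m := n) (by omega)
  have h5 : ∀ k, fibPos (Nat.fib (n - 1)) + (Nat.fib (n - 1) + k) ≤
      fibPos (Nat.fib (n - 1) + k) + Nat.fib (n - 1) := fun k =>
    add_le_add_of_lt_succ (f := fibPos) (K := Nat.fib (n - 1) + k) (fun _ _ => fibPos_lt_succ _) (by omega) le_rfl
  exact
  { apply_short := fun a ha => by rw [fibBlockSubst, if_pos ha]
    apply_long := fun a ha => by
      rw [fibBlockSubst, if_neg (by omega), Nat.add_sub_cancel' ha, ← add_assoc,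
        Nat.add_sub_cancel' ha]
    short_lt := fun a _ => fibPos_lt_succ a
    long_lt := fun k _ => by
      have := fibPos_lt_succ (Nat.fib (n - 1) + k)
      have := h5 k
      rw [← add_assoc]
      omega
    short_zero := rfl
    long_zero := by simp [h3]
    short_last := h3
    long_last := by
      rw [← h1, h4]; omega
    two_le := by decide }

theorem fibBlock_eq_factor (N a : ℕ) : fibBlock N a = factor fibWord N a := rfl

theorem blockImage_factor {N : ℕ} (hN : 0 < N) (p : ℕ) :
    blockImage fibSubst N (factor fibWord N p) =
      (List.range (fibPos (p + 1) - fibPos p)).map fun i => factor fibWord N (fibPos p + i) := by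
  have h0 := length_factor_flatMap 1 p
  rw [blockImage, take_factor _ _ _ _ hN,
    show ((factor fibWord 1 p).flatMap fibSubst).length = fibPos (p + 1) - fibPos p by omega]
  refine List.map_congr_left fun i hi => ?_
  rw [List.mem_range] at hi
  -- The last N - 1 letters of the block have images of total length at least N - 1, so every window
  -- taken fits.
  have h2 := add_le_add_of_lt_succ (f := fibPos) (K := p + N) (fun _ _ => fibPos_lt_succ _)
    (show p + 1 ≤ p + N by omega) le_rfl
  rw [factor_flatMap, drop_factor _ _ _ _ (by omega), take_factor _ _ _ _ (by omega)]

theorem isBlockSubstitution_fibBlockSubst {n : ℕ} (hn : 3 ≤ n) :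
    IsBlockSubstitution fibSubst (Nat.fib n - 1)
      (fun a : Fin (Nat.fib n) => fibBlock (Nat.fib n - 1) a) (fibBlockSubst n) := by
  obtain ⟨C, hC⟩ := exists_isFibCoding (n := n) (by omega)
  have h1 := fib_eq_add (n := n) (by omega)
  have h2 : Nat.fib 3 ≤ Nat.fib n := Nat.fib_mono hn
  have hη := isIntervalSubst_fibBlockSubst hn
  rw [show Nat.fib 3 = 2 from rfl] at h2
  have hcode : ∀ l p, (factor C l p).map (fun a : Fin (Nat.fib n) => fibBlock (Nat.fib n - 1) a) =
      (List.range l).map fun i => factor fibWord (Nat.fib n - 1) (p + i) := fun l p => by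
    rw [map_factor]
    exact List.map_congr_left fun i _ => hC (p + i)
  refine ⟨⟨fun a _ => ⟨?_, by simp [fibBlock_eq_factor]⟩, fun a _ b _ hab => ?_, ?_⟩,
    (hC.forall_iff (by omega)).2 ⟨fun a ha => ?_, fun k hk => ?_⟩⟩
  · rw [language_fibSubst]
    exact factor_mem_factors _ _ _
  · exact Fin.ext (factor_fibWord_injOn (by omega) a.2 b.2 hab)
  · rintro w ⟨hw, hwl⟩
    rw [language_fibSubst] at hw
    obtain ⟨p, hp⟩ := hw
    rw [hwl] at hp
    exact ⟨C p, trivial, (hC p).trans hp.symm⟩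
  · rw [hη.apply_short_eq hC ha, hcode, hC.val_apply (by omega), fibBlock_eq_factor,
      blockImage_factor (by omega)]
  · have h3 : fibPos (Nat.fib (n - 1)) = Nat.fib n := by
      rw [fibPos_fib (by omega), Nat.sub_add_cancel (by omega)]
    have h5 := add_le_add_of_lt_succ (f := fibPos) (K := Nat.fib (n - 1) + k)
      (fun _ _ => fibPos_lt_succ _) (show Nat.fib (n - 1) ≤ Nat.fib (n - 1) + k by omega) le_rfl
    have h6 := fibPos_lt_succ (Nat.fib (n - 1) + k)
    have h7 := hη.long_le (show k + 1 ≤ Nat.fib (n - 2) by omega)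
    rw [← add_assoc] at h7
    rw [hη.apply_long_eq hC (by omega) hk, hcode, hC.val_apply (by omega), fibBlock_eq_factor,
      blockImage_factor (by omega)]
    rw [← add_assoc, show fibPos (Nat.fib (n - 1) + k + 1) - Nat.fib n -
      (fibPos (Nat.fib (n - 1) + k) - Nat.fib n) = fibPos (Nat.fib (n - 1) + k + 1) -
        fibPos (Nat.fib (n - 1) + k) by omega]
    refine List.map_congr_left fun i hi => ?_
    rw [List.mem_range] at hi
    rw [← hC.eq_iff, ← hC.fib_add (by omega) le_rfl (j := fibPos (Nat.fib (n - 1) + k) -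
      Nat.fib n + i) (by omega)]
    congr 1
    omega

end Block

/-! ### The cuts of the explicit family. -/

section Cuts

theorem rotatedWord_eq {n : ℕ} (hn : 4 ≤ n) :
    rotatedWord n = factor fibWord (Nat.fib (n - 2) - 1) 1 ++ [0] := by
  obtain ⟨k, rfl⟩ := Nat.exists_eq_add_of_le' hn
  have h : Nat.fib (k + 2) = Nat.fib (k + 2) - 1 + 1 :=
    (Nat.sub_add_cancel (Nat.fib_pos.2 (by omega))).symm
  rw [rotatedWord, Nat.add_sub_cancel, iter_fibSubst_eq_factor, h, factor_succ]
  simp [show fibWord 0 = 0 from rfl]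

theorem cutL_eq_sum (n k : ℕ) :
    cutL n k = (((rotatedWord n).take k).map fun c : Fin 2 => 2 - (c : ℕ)).sum := by
  rw [cutL]
  congr 1
  induction (rotatedWord n).take k with
  | nil => rfl
  | cons a w ih => simpa using ih

/-- The rotation removes the initial 0 of the Fibonacci word, whose image has length 2. For k =
F_{n-2} the formula fails, as the removed 0 is back at the end; `cutL_fib` covers that case. -/
theorem cutL_add_two {n k : ℕ} (hn : 4 ≤ n) (hk : k < Nat.fib (n - 2)) :
    cutL n k + 2 = fibPos (k + 1) := by
  rw [cutL_eq_sum, rotatedWord_eq hn, List.take_append_of_le_length (by rw [length_factor]; omega),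
    take_factor _ _ _ _ (by omega), add_comm, add_comm k 1, ← fibPos_add_sum_map]
  rfl

theorem cutL_fib {n : ℕ} (hn : 4 ≤ n) : cutL n (Nat.fib (n - 2)) = Nat.fib (n - 1) := by
  have h : 0 < Nat.fib (n - 2) := Nat.fib_pos.2 (by omega)
  have h1 := fibPos_add_sum_map (Nat.fib (n - 2) - 1) 1
  rw [show 1 + (Nat.fib (n - 2) - 1) = Nat.fib (n - 2) by omega, fibPos_fib (by omega),
    show n - 2 + 1 = n - 1 by omega, show fibPos 1 = 2 from rfl] at h1
  rw [cutL_eq_sum, rotatedWord_eq hn, List.take_of_length_le (by simp; omega), List.map_append,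
    List.sum_append, ← h1, add_comm]
  rfl

theorem cutL_lt_succ {n k : ℕ} (hn : 4 ≤ n) (hk : k < Nat.fib (n - 2)) :
    cutL n k < cutL n (k + 1) ∧ cutL n (k + 1) ≤ cutL n k + 2 := by
  have h1 := cutL_add_two hn hk
  have h4 := fibPos_lt_succ (k + 1)
  have h5 := fibPos_succ_le (k + 1)
  rcases (show k + 1 ≤ Nat.fib (n - 2) from hk).eq_or_lt with h2 | h2
  · have h3 := cutL_fib hn
    have h6 := fibPos_fib (m := n - 2) (by omega)
    rw [show n - 2 + 1 = n - 1 by omega] at h6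
    rw [h2] at h1 h4 h5 ⊢
    omega
  · have h3 := cutL_add_two hn h2
    omega

/-- The moved letter 0 gives the last image length 2, so the last cut before the end is F_{n-1} - 2;
going back, each image has length at least 1. Consequently F_{n-1} - 1 is no cut of L, and the
descent in `exists_two_le_length_iter_eta` is strict. -/
theorem cutL_add_le {n k : ℕ} (hn : 4 ≤ n) (hk : k < Nat.fib (n - 2)) :
    cutL n k + Nat.fib (n - 2) + 1 ≤ Nat.fib (n - 1) + k := by
  have h1 := cutL_add_two (n := n) (k := Nat.fib (n - 2) - 1) hn (by omega)
  have h2 := fibPos_fib (m := n - 2) (by omega)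
  have h3 := add_le_add_of_lt_succ (f := cutL n) (K := Nat.fib (n - 2))
    (fun a ha => (cutL_lt_succ hn ha).1) (show k ≤ Nat.fib (n - 2) - 1 by omega) (by omega)
  rw [show n - 2 + 1 = n - 1 by omega] at h2
  rw [Nat.sub_add_cancel (by omega), h2] at h1
  omega

theorem cutL_zero (n : ℕ) : cutL n 0 = 0 := by
  rw [cutL_eq_sum]; rfl

theorem two_le_fib_sub_two {n : ℕ} (hn : 5 ≤ n) : 2 ≤ Nat.fib (n - 2) :=
  Nat.fib_mono (show 3 ≤ n - 2 by omega)

theorem cutL_one {n : ℕ} (hn : 5 ≤ n) : cutL n 1 = 1 := by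
  have h := cutL_add_two (n := n) (k := 1) (by omega) (two_le_fib_sub_two hn)
  rw [show fibPos (1 + 1) = 3 by decide] at h
  omega

theorem cutL_lt {n k : ℕ} (hn : 4 ≤ n) (hk : k < Nat.fib (n - 2)) :
    cutL n k < Nat.fib (n - 1) := by
  have := cutL_add_le hn hk
  omega

theorem mem_cutsS {n c : ℕ} : c ∈ cutsS n ↔
    c < Nat.fib (n - 1) ∧ (c = 0 ∨ ∀ k < Nat.fib (n - 2), c ≠ cutL n k) := by
  simp [cutsS]

theorem pairwise_cutsS (n : ℕ) : (cutsS n).Pairwise (· < ·) :=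
  List.pairwise_lt_range.filter _

/-- Of the F_{n-1} candidates, the F_{n-2} - 1 inner cuts of L are removed; the cut at 0 is kept. -/
theorem length_cutsS {n : ℕ} (hn : 4 ≤ n) : (cutsS n).length = Nat.fib (n - 3) + 1 := by
  have h0 : 0 < Nat.fib (n - 1) := Nat.fib_pos.2 (by omega)
  have h1 : Nat.fib (n - 1) = Nat.fib (n - 2) + Nat.fib (n - 3) := fib_eq_add (by omega)
  have h2 : 0 < Nat.fib (n - 2) := Nat.fib_pos.2 (by omega)
  have h3 : ∀ a < Nat.fib (n - 2), cutL n a < cutL n (a + 1) := fun a ha => (cutL_lt_succ hn ha).1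
  have h4 : (cutsS n).toFinset = Finset.range (Nat.fib (n - 1)) \
      (Finset.Ico 1 (Nat.fib (n - 2))).image (cutL n) := by
    ext c
    simp only [List.mem_toFinset, mem_cutsS, Finset.mem_sdiff, Finset.mem_range, Finset.mem_image,
      Finset.mem_Ico, not_exists, not_and]
    refine and_congr_right fun _ => ⟨?_, fun h => ?_⟩
    · rintro (rfl | h) k hk
      · intro h5
        have := eq_of_lt_succ h3 (Nat.zero_le _) hk.2.le ((cutL_zero n).trans h5.symm)
        omega
      · exact fun h5 => h k hk.2 h5.symm
    · refine or_iff_not_imp_left.2 fun hc k hk h5 => ?_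
      rcases Nat.eq_zero_or_pos k with rfl | h6
      · exact hc (h5.trans (cutL_zero n))
      · exact h k ⟨h6, hk⟩ h5.symm
  rw [← List.toFinset_card_of_nodup (pairwise_cutsS n).nodup, h4, Finset.card_sdiff_of_subset,
    Finset.card_image_of_injOn, Finset.card_range, Nat.card_Ico]
  · omega
  · intro a ha b hb hab
    rw [Finset.mem_coe, Finset.mem_Ico] at ha hb
    exact eq_of_lt_succ h3 ha.2.le hb.2.le hab
  · intro c hc
    obtain ⟨k, hk, rfl⟩ := Finset.mem_image.1 hc
    exact Finset.mem_range.2 (cutL_lt hn (Finset.mem_Ico.1 hk).2)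

/-- The cuts of L advance by at most 2 and cannot jump over two adjacent positions; for c = 0 the
position 1 is a cut of L. So the images of the letters of S have length at least 2. -/
theorem succ_notMem_cutsS {n c : ℕ} (hn : 5 ≤ n) (hc : c ∈ cutsS n) : c + 1 ∉ cutsS n := by
  intro hc'
  rw [mem_cutsS] at hc hc'
  have h1 := hc'.2.resolve_left (Nat.succ_ne_zero c)
  have h2 := two_le_fib_sub_two hn
  rcases hc.2 with rfl | h
  · exact h1 1 h2 (cutL_one hn).symm
  · have h0 := h 0 (by omega)
    rw [cutL_zero] at h0
    have key : ∀ k < Nat.fib (n - 2), cutL n k < c := by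
      intro k hk
      induction k with
      | zero => rw [cutL_zero]; omega
      | succ k ih =>
        have h3 := ih (by omega)
        have h4 := (cutL_lt_succ (n := n) (k := k) (by omega) (by omega)).2
        have h5 := h _ hk
        have h6 := h1 _ hk
        omega
    have h3 := key (Nat.fib (n - 2) - 1) (by omega)
    have h4 := (cutL_lt_succ (n := n) (k := Nat.fib (n - 2) - 1) (by omega) (by omega)).2
    rw [Nat.sub_add_cancel (by omega), cutL_fib (by omega)] at h4
    omega

theorem getD_cutsS_add_two_le {n i : ℕ} (hn : 5 ≤ n) (hi : i < Nat.fib (n - 3)) :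
    (cutsS n).getD i 0 + 2 ≤ (cutsS n).getD (i + 1) 0 := by
  have hl := length_cutsS (n := n) (by omega)
  rw [List.getD_eq_getElem _ _ (by omega), List.getD_eq_getElem _ _ (by omega)]
  have h1 := List.pairwise_iff_getElem.1 (pairwise_cutsS n) i (i + 1) (by omega) (by omega)
    (by omega)
  have h2 := succ_notMem_cutsS hn (List.getElem_mem (l := cutsS n) (n := i) (by omega))
  have h3 := List.getElem_mem (l := cutsS n) (n := i + 1) (by omega)
  by_contra h4
  rw [show (cutsS n)[i] + 1 = (cutsS n)[i + 1] by omega] at h2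
  exact h2 h3

theorem getD_cutsS_mem {n i : ℕ} (hn : 4 ≤ n) (hi : i ≤ Nat.fib (n - 3)) :
    (cutsS n).getD i 0 ∈ cutsS n := by
  have hl := length_cutsS (n := n) (by omega)
  rw [List.getD_eq_getElem _ _ (by omega)]
  exact List.getElem_mem _

theorem exists_getD_cutsS {n c : ℕ} (hn : 4 ≤ n) (hc : c ∈ cutsS n) :
    ∃ i ≤ Nat.fib (n - 3), (cutsS n).getD i 0 = c := by
  have hl := length_cutsS (n := n) (by omega)
  obtain ⟨i, hi, rfl⟩ := List.getElem_of_mem hc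
  exact ⟨i, by omega, List.getD_eq_getElem _ _ _⟩

theorem getD_cutsS_zero {n : ℕ} (hn : 5 ≤ n) : (cutsS n).getD 0 0 = 0 := by
  have h0 : 0 ∈ cutsS n := mem_cutsS.2 ⟨Nat.fib_pos.2 (by omega), Or.inl rfl⟩
  obtain ⟨i, hi, h⟩ := exists_getD_cutsS (by omega) h0
  have := add_le_add_of_lt_succ (f := fun i => (cutsS n).getD i 0) (K := Nat.fib (n - 3))
    (fun a ha => by have := getD_cutsS_add_two_le hn ha; omega) (Nat.zero_le i) hi
  omega

theorem getD_cutsS_last {n : ℕ} (hn : 5 ≤ n) :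
    (cutsS n).getD (Nat.fib (n - 3)) 0 = Nat.fib (n - 1) - 1 := by
  have h0 : Nat.fib (n - 1) - 1 ∈ cutsS n := by
    refine mem_cutsS.2 ⟨Nat.sub_lt (Nat.fib_pos.2 (by omega)) one_pos, Or.inr fun k hk h => ?_⟩
    have := cutL_add_le (n := n) (by omega) hk
    omega
  obtain ⟨i, hi, h⟩ := exists_getD_cutsS (by omega) h0
  have h1 := add_le_add_of_lt_succ (f := fun i => (cutsS n).getD i 0) (K := Nat.fib (n - 3))
    (fun a ha => by have := getD_cutsS_add_two_le hn ha; omega) hi le_rfl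
  have h2 := (mem_cutsS.1 (getD_cutsS_mem (n := n) (by omega) le_rfl)).1
  omega

/-- The cuts between the images of the letters `a < F_{n-1}` under `eta n`. -/
def etaCut (n a : ℕ) : ℕ :=
  if a ≤ Nat.fib (n - 3) then (cutsS n).getD a 0 else a + Nat.fib (n - 2)

theorem isIntervalSubst_eta {n : ℕ} (hn : 5 ≤ n) :
    IsIntervalSubst n (etaCut n) (cutL n) (eta n) := by
  have h1 := fib_eq_add (n := n) (by omega)
  have h2 : Nat.fib (n - 1) = Nat.fib (n - 2) + Nat.fib (n - 3) := fib_eq_add (by omega)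
  have h3 : 0 < Nat.fib (n - 3) := Nat.fib_pos.2 (by omega)
  have h4 : 0 < Nat.fib (n - 2) := Nat.fib_pos.2 (by omega)
  have h5 := getD_cutsS_last hn
  exact
  { apply_short := fun a ha => by
      rw [eta]
      rcases lt_trichotomy (a : ℕ) (Nat.fib (n - 3)) with h | h | h
      · rw [if_pos h, etaCut, etaCut, if_pos h.le, if_pos (by omega)]
      -- The first letter of M bridges the last cut F_{n-1} - 1 of S and the cut F_{n-1} + 1,
      -- skipping F_{n-1}, which is the final cut of L.
      · rw [if_neg (by omega), if_pos h, etaCut, etaCut, if_pos h.le, if_neg (by omega), h, h5,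
          show Nat.fib (n - 1) + 1 = Nat.fib (n - 3) + 1 + Nat.fib (n - 2) by omega]
      · rw [if_neg (by omega), if_neg (by omega), if_pos ha, etaCut, etaCut, if_neg (by omega),
          if_neg (by omega), add_right_comm]
    apply_long := fun a ha => by
      rw [eta, if_neg (by omega), if_neg (by omega), if_neg (by omega)]
    short_lt := fun a ha => by
      rcases lt_trichotomy a (Nat.fib (n - 3)) with h | h | h
      · have := getD_cutsS_add_two_le hn h
        rw [etaCut, etaCut, if_pos h.le, if_pos (by omega)]
        omega
      · rw [etaCut, etaCut, if_pos h.le, if_neg (by omega), h, h5]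
        omega
      · rw [etaCut, etaCut, if_neg (by omega), if_neg (by omega)]
        omega
    long_lt := fun k hk => (cutL_lt_succ (by omega) hk).1
    short_zero := by rw [etaCut, if_pos (by omega), getD_cutsS_zero hn]
    long_zero := cutL_zero n
    short_last := by rw [etaCut, if_neg (by omega)]; omega
    long_last := cutL_fib (by omega)
    two_le := by
      have := getD_cutsS_add_two_le hn h3
      rw [etaCut, if_pos (show 1 ≤ _ from h3)]
      rw [zero_add] at this
      omega }

end Cuts

/-! ### The properties of the explicit family. -/

section Eta

variable {n : ℕ}

/-- Complementarity leaves 0 as the only common starting point of images from both partitions, and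
there the lengths differ: at least 2 on one side, 1 on the other because of the rotation. -/
theorem injective_eta (hn : 5 ≤ n) : Function.Injective (eta n) := by
  obtain ⟨C, hC⟩ := exists_isFibCoding (n := n) (by omega)
  have hη := isIntervalSubst_eta hn
  refine hη.injective hC (by omega) fun a ha k hk h h' => ?_
  have h1 := cutL_lt (n := n) (by omega) hk
  have h2 : Nat.fib (n - 1) = Nat.fib (n - 2) + Nat.fib (n - 3) := fib_eq_add (by omega)
  have h3 : a ≤ Nat.fib (n - 3) := by
    by_contra h3
    rw [etaCut, if_neg h3] at h
    omega
  have h4 := getD_cutsS_mem (n := n) (by omega) h3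
  rw [etaCut, if_pos h3] at h
  rw [h] at h4
  have h5 := (mem_cutsS.1 h4).2.resolve_right fun h5 => h5 k hk rfl
  have h6 : k = 0 :=
    eq_of_lt_succ hη.long_lt hk.le (Nat.zero_le _) (h5.trans hη.long_zero.symm)
  have h7 : a = 0 := by
    refine eq_of_lt_succ hη.short_lt ha.le (Nat.zero_le _) ?_
    rw [hη.short_zero, etaCut, if_pos h3, h, h5]
  subst h6 h7
  have := hη.two_le
  rw [zero_add, cutL_one hn] at h'
  omega

theorem det_incidence_eta_ne_zero (hn : 5 ≤ n) : (incidence (eta n)).det ≠ 0 := by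
  obtain ⟨C, hC⟩ := exists_isFibCoding (n := n) (by omega)
  refine (isIntervalSubst_eta hn).det_ne_zero hC (by omega) fun j hj => ?_
  have h1 := fib_eq_add (n := n) (by omega)
  have h2 : Nat.fib (n - 1) = Nat.fib (n - 2) + Nat.fib (n - 3) := fib_eq_add (by omega)
  rcases lt_trichotomy j (Nat.fib (n - 1)) with h | rfl | h
  · by_cases hj : j ∈ cutsS n
    · obtain ⟨i, hi, h3⟩ := exists_getD_cutsS (by omega) hj
      exact Or.inl ⟨i, by omega, by rw [etaCut, if_pos hi, h3]⟩
    · simp only [mem_cutsS, h, true_and, not_or, not_forall, not_not] at hj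
      obtain ⟨-, k, hk, h3⟩ := hj
      exact Or.inr ⟨k, hk.le, h3.symm⟩
  · exact Or.inr ⟨_, le_rfl, cutL_fib (by omega)⟩
  · exact Or.inl ⟨j - Nat.fib (n - 2), by omega, by rw [etaCut, if_neg (by omega)]; omega⟩

/-- Letters a ≤ F_{n-3} have images of length at least 2. A larger a < F_{n-1} goes to the single
letter F_{n-1} + k with k = a - F_{n-3}, which either splits or goes to the single letter `cutL n k`
< a. Strong induction on a finishes. -/
theorem exists_two_le_length_iter_eta (hn : 5 ≤ n) (a : Fin (Nat.fib n)) :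
    ∃ k, 2 ≤ (iter (eta n) k [a]).length := by
  obtain ⟨C, hC⟩ := exists_isFibCoding (n := n) (by omega)
  have hη := isIntervalSubst_eta hn
  have h1 := fib_eq_add (n := n) (by omega)
  have h2 : Nat.fib (n - 1) = Nat.fib (n - 2) + Nat.fib (n - 3) := fib_eq_add (by omega)
  have hlong : ∀ k < Nat.fib (n - 2), (∃ m, 2 ≤ (iter (eta n) m [C (cutL n k)]).length) →
      ∃ m, 2 ≤ (iter (eta n) m [C (Nat.fib (n - 1) + k)]).length := by
    rintro k hk ⟨m, hm⟩
    have h3 := cutL_lt_succ (n := n) (by omega) hk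
    have h4 := hη.apply_long_eq hC (by omega) hk
    rcases (show cutL n (k + 1) - cutL n k = 1 ∨ cutL n (k + 1) - cutL n k = 2 by omega)
      with h5 | h5
    · refine ⟨m + 1, ?_⟩
      rwa [iter_succ, List.flatMap_singleton, h4, h5]
    · refine ⟨1, ?_⟩
      rw [iter_succ, List.flatMap_singleton, h4, h5, iter_zero, length_factor]
  have hshort : ∀ a < Nat.fib (n - 1), ∃ m, 2 ≤ (iter (eta n) m [C a]).length := by
    intro a
    induction a using Nat.strong_induction_on with
    | _ a ih =>
      intro ha
      have h4 := hη.apply_short_eq hC ha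
      rcases le_or_gt a (Nat.fib (n - 3)) with h | h
      · refine ⟨1, ?_⟩
        rw [iter_succ, List.flatMap_singleton, h4, iter_zero, length_factor, etaCut, etaCut,
          if_pos h]
        rcases h.eq_or_lt with h | h
        · rw [if_neg (by omega), h, getD_cutsS_last hn]
          omega
        · have := getD_cutsS_add_two_le hn h
          rw [if_pos (by omega)]
          omega
      · have h5 := cutL_add_le (n := n) (k := a - Nat.fib (n - 3)) (by omega) (by omega)
        obtain ⟨m, hm⟩ := hlong (a - Nat.fib (n - 3)) (by omega) (ih _ (by omega) (by omega))
        refine ⟨m + 1, ?_⟩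
        rw [iter_succ, List.flatMap_singleton, h4, etaCut, etaCut, if_neg (by omega),
          if_neg (by omega), show a + 1 + Nat.fib (n - 2) - (a + Nat.fib (n - 2)) = 1 by omega,
          show a + Nat.fib (n - 2) = Nat.fib (n - 1) + (a - Nat.fib (n - 3)) by omega]
        exact hm
  revert a
  exact (hC.forall_iff (by omega)).2
    ⟨hshort, fun k hk => hlong k hk (hshort _ (cutL_lt (by omega) hk))⟩

theorem isFibonacciLike_eta (hn : 5 ≤ n) : IsFibonacciLike (eta n) := by
  obtain ⟨C, hC⟩ := exists_isFibCoding (n := n) (by omega)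
  have hη := (isIntervalSubst_eta hn).isReshaped hC (by omega)
  exact
  { isSubstitution := hη.isSubstitution
    primitive := hη.isPrimitive hC (by omega) (exists_two_le_length_iter_eta hn)
    injective := injective_eta hn
    eigenvalue := hη.isPerronFrobeniusEigenvalue hC (by omega)
    conjugate := hη.conjugate hC (by omega) }

theorem isPartitionReshaping_eta (hn : 5 ≤ n) :
    IsPartitionReshaping (fibBlockSubst n) (eta n) (fibBlocks n) := by
  obtain ⟨C, hC⟩ := exists_isFibCoding (n := n) (by omega)
  have hη := (isIntervalSubst_eta hn).isReshaped hC (by omega)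
  have hθ := (isIntervalSubst_fibBlockSubst (n := n) (by omega)).isReshaped hC (by omega)
  have h1 := fib_eq_add (n := n) (by omega)
  have hb : fibBlocks n =
      [factor C (Nat.fib (n - 1)) 0, factor C (Nat.fib (n - 2)) (Nat.fib (n - 1))] := by
    rw [fibBlocks, hC.interval_eq (by omega), hC.interval_eq le_rfl, Nat.sub_zero,
      show Nat.fib n - Nat.fib (n - 1) = Nat.fib (n - 2) by omega]
  have hf : (fibBlocks n).flatten = factor C (Nat.fib n) 0 := by
    rw [hb, factor_fib_eq_append C (n := n) (by omega)]
    simp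
  refine ⟨hf ▸ hC.nodup_factor, fun a => hf ▸ hC.mem_factor a, ?_, ?_⟩
  · rw [hb]
    simp only [List.mem_cons, List.not_mem_nil, or_false, forall_eq_or_imp, forall_eq]
    exact ⟨hη.flatMap_short.trans hθ.flatMap_short.symm,
      hη.flatMap_long.trans hθ.flatMap_long.symm⟩
  · rw [hη.language_eq hC (by omega), hθ.language_eq hC (by omega)]

end Eta

end Substitutions

theorem mainTheorem1 :
    {η : Σ r : ℕ, (Fin r → List (Fin r)) | Substitutions.IsFibonacciLike η.2}.Infinite ∧
    ∀ n : ℕ, 5 ≤ n →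
      Substitutions.IsFibonacciLike (Substitutions.eta n) ∧
      (Substitutions.incidence (Substitutions.eta n)).det ≠ 0 ∧
      ∃ φN : Fin (Nat.fib n) → List (Fin (Nat.fib n)),
        Substitutions.IsBlockSubstitution Substitutions.fibSubst (Nat.fib n - 1)
          (fun a : Fin (Nat.fib n) => Substitutions.fibBlock (Nat.fib n - 1) a) φN ∧
        Substitutions.IsPartitionReshaping φN (Substitutions.eta n)
          (Substitutions.fibBlocks n) := by
  refine ⟨Set.infinite_of_injective_forall_mem
    (f := fun n : ℕ => ⟨Nat.fib (n + 5), Substitutions.eta (n + 5)⟩) (fun m n h => ?_)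
    fun n => Substitutions.isFibonacciLike_eta (by omega), fun n hn =>
      ⟨Substitutions.isFibonacciLike_eta hn, Substitutions.det_incidence_eta_ne_zero hn,
        Substitutions.fibBlockSubst n,
        Substitutions.isBlockSubstitution_fibBlockSubst (by omega),
        Substitutions.isPartitionReshaping_eta hn⟩⟩
  -- Different members of the family live on alphabets of different sizes.
  have h1 : Nat.fib (m + 5) = Nat.fib (n + 5) := congrArg Sigma.fst h
  exact Nat.add_right_cancel (Nat.fib_add_two_strictMono.injective (a₁ := m + 3) (a₂ := n + 3) h1)
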